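/- A permutation $\pi=\pi_1\cdots\pi_m$ of $\{1,\dots,m\}$ is a \emph{pattern} of a permutation $\sigma=\sigma_1\cdots\sigma_k$ of $\{1,\dots,k\}$ if there are indices $1\le i_1<\dots<i_m\le k$ such that $\sigma_{i_a}<\sigma_{i_b}$ whenever $\pi_a<\pi_b$; otherwise $\sigma$ \emph{avoids} $\pi$. A permutation is \emph{separable} if it avoids both $3\,1\,4\,2$ and $2\,4\,1\,3$. A \emph{longest common pattern} of $\sigma$ and $\tau$ is a permutation of maximal size among those that are patterns of both $\sigma$ and $\tau$ (the empty permutation is allowed). The problem of finding a longest common pattern between two permutations, the first one being separable, is in $\mathrm{P}$: there is a Turing machine that, given as input a separable permutation $\sigma$ of $\{1,\dots,k\}$ and an arbitrary permutation $\tau$ of $\{1,\dots,n\}$, written as the words $\sigma_1\cdots\sigma_k$ and $\tau_1\cdots\tau_n$, outputs a longest common pattern of $\sigma$ and $\tau$ in a number of steps bounded by a polynomial in the length of the input (equivalently, by a polynomial in $k+n$). -/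

import Mathlib

/-- A permutation of `{1, …, n}`, for some `n`, bundled with its size `n`. The set `{1, …, n}` is
represented by `Fin n = {0, …, n - 1}`. -/
abbrev Permutation : Type := Σ n : ℕ, Equiv.Perm (Fin n)

namespace Permutation

/-- The size of a permutation. -/
abbrev size (π : Permutation) : ℕ := π.1

/-- `π` is a pattern of `σ` (`π` is involved in `σ`, `σ` contains `π`): there are positions
`i₁ < i₂ < … < iₖ` of `σ` such that `σ (i_l) < σ (i_m)` whenever `π l < π m`. -/
def IsPattern (π σ : Permutation) : Prop :=
  ∃ i : Fin π.1 → Fin σ.1, StrictMono i ∧ ∀ l m, π.2 l < π.2 m → σ.2 (i l) < σ.2 (i m)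

/-- The permutation `3 1 4 2` (with values and positions counted from `0`). -/
def p3142 : Permutation :=
  ⟨4, { toFun := ![2, 0, 3, 1], invFun := ![1, 3, 0, 2],
        left_inv := by decide, right_inv := by decide }⟩

/-- The permutation `2 4 1 3` (with values and positions counted from `0`). -/
def p2413 : Permutation :=
  ⟨4, { toFun := ![1, 3, 0, 2], invFun := ![2, 0, 3, 1],
        left_inv := by decide, right_inv := by decide }⟩

/-- A permutation is separable if it avoids the patterns `3 1 4 2` and `2 4 1 3`. -/
def IsSeparable (σ : Permutation) : Prop :=
  ¬ IsPattern p3142 σ ∧ ¬ IsPattern p2413 σ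

/-- `π` is a common pattern of `σ` and `τ`. -/
def IsCommonPattern (π σ τ : Permutation) : Prop :=
  IsPattern π σ ∧ IsPattern π τ

/-- `π` is a longest common pattern of `σ` and `τ`: a common pattern of maximal size. -/
def IsLongestCommonPattern (π σ τ : Permutation) : Prop :=
  IsCommonPattern π σ τ ∧ ∀ ρ : Permutation, IsCommonPattern ρ σ τ → ρ.size ≤ π.size

/-- The word `π₁ π₂ … πₙ` of a permutation `π` of `{1, …, n}`, a list of numbers between
`1` and `n`. -/
def word (π : Permutation) : List ℕ :=
  List.ofFn fun i : Fin π.1 => (π.2 i : ℕ) + 1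

/-- A list of natural numbers as a string of bits: each number `v` is written as `v` ones followed
by a zero. -/
def encodeWord (w : List ℕ) : List Bool :=
  w.flatMap fun v => List.replicate v true ++ [false]

theorem encodeWord_injective : Function.Injective encodeWord := by
  have key : ∀ (a b : ℕ) (u v : List Bool),
      List.replicate a true ++ false :: u = List.replicate b true ++ false :: v →
        a = b ∧ u = v := by
    intro a
    induction a with
    | zero =>
      intro b u v h
      cases b with
      | zero => simpa using h
      | succ b => simp [List.replicate_succ] at h
    | succ a ih =>
      intro b u v h
      cases b with
      | zero => simp [List.replicate_succ] at h
      | succ b =>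
        have := ih b u v (by simpa [List.replicate_succ] using h)
        exact ⟨by rw [this.1], this.2⟩
  intro x
  induction x with
  | nil =>
    intro y h
    cases y with
    | nil => rfl
    | cons b y => simp [encodeWord] at h
  | cons a x ih =>
    intro y h
    cases y with
    | nil => simp [encodeWord] at h
    | cons b y =>
      have h' := key a b (encodeWord x) (encodeWord y) (by simpa [encodeWord] using h)
      rw [h'.1, ih h'.2]

theorem word_injective : Function.Injective word := by
  rintro ⟨n, π⟩ ⟨m, ρ⟩ h
  have hn : n = m := by simpa [word] using congrArg List.length h
  subst hn
  have h' := List.ofFn_injective h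
  congr 1
  ext i
  simpa using congrFun h' i

open Classical in
/-- The encoding of permutations as strings over `{0, 1}`: the word `π₁ π₂ … πₙ`, each entry `πᵢ`
being written as `πᵢ` ones followed by a zero. As the entries are exactly `1, …, n`, the string has
length `n (n + 3) / 2`, so that polynomial in its length means polynomial in the size `n`. -/
noncomputable def encoding : Computability.Encoding Permutation Bool where
  encode π := encodeWord π.word
  decode s := if h : ∃ π : Permutation, encodeWord π.word = s then some h.choose else none
  decode_encode π := by
    have h : ∃ ρ : Permutation, encodeWord ρ.word = encodeWord π.word := ⟨π, rfl⟩
    rw [dif_pos h]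
    exact congrArg some (word_injective (encodeWord_injective h.choose_spec))

end Permutation

/-- A search problem, given by the relation `R a b` (`b` is a solution for the instance `a`), is
solvable in polynomial time, for instances encoded by `ea` and solutions encoded by `eb`: a Turing
machine computes a solution for every instance, in a number of steps that is bounded by a
polynomial in the length of the encoding of the instance. -/
def SolvableInPolyTime {α β αΓ βΓ : Type} (ea : α → List αΓ) (eb : β → List βΓ)
    (R : α → β → Prop) : Prop :=
  ∃ f : α → β, (∀ a, R a (f a)) ∧ Nonempty (Turing.TM2ComputableInPolyTime ea eb f)

/-- An instance: a pair of permutations, the first one being separable. -/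
abbrev SeparablePair : Type :=
  {p : Permutation × Permutation // p.1.IsSeparable}

/-- Encoding of instances: the encoding of the first permutation followed by the encoding of the
second one, over two disjoint copies of `{0, 1}`. -/
noncomputable def encodeSeparablePair (p : SeparablePair) : List (Bool ⊕ Bool) :=
  (Computability.encodingProd Permutation.encoding Permutation.encoding).encode p.1

/-! A common pattern of σ and τ amounts to a list of matches, each pairing an entry of σ with an
entry of τ, such that positions increase in both permutations and values compare alike in both
(`Consistent`). Two occurrences of the pattern give such a list
(`IsCommonPattern.exists_consistent`), and the ranks of the values give back a pattern
(`Consistent.exists_pattern`).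

The values in σ along such a list form a subsequence of σ, so they again avoid 3142 and 2413. A word
of this kind with at least two letters is a concatenation of two nonempty words, one of which lies
entirely below the other (`SepWord.splits`). This justifies a dynamic program over boxes in the four
coordinates (position and value in σ, position and value in τ). If a consistent list is split in
this way, the bounding boxes of the two parts are separated in all four coordinates, so any
consistent lists inside these boxes can replace the parts. By induction on the length, the table
contains after `n` rounds a list that is at least as good as any given one of length at most `n`
(`exists_mem_improve_iterate`). With `G` the list of all matches there are (4|G|)^8 boxes, every
stored list has at most |G| entries, and |G| rounds suffice.

To reach Turing machines, data are coded by binary trees and `PolyTime` functions are those computed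
by structured stack programs in polynomial time with values of polynomial size. They are closed
under composition, pairing, case distinction and iteration with polynomially bounded iterates
(`PolyTime.iterate`), from which the whole algorithm is assembled (`PolyTime.solution`).
`PolyTime.computable` compiles the program to a machine. -/

open Turing StateTransition

/-! ### Structured stack programs and their compilation to machines -/

/-- `ReachesIn f a b t`: iterating the partial step function `f` leads from `a` to `b` in at most
`t` steps. -/
def ReachesIn {C : Type*} (f : C → Option C) (a b : C) (t : ℕ) : Prop :=
  ∃ s ≤ t, (flip bind f)^[s] (some a) = some b

namespace ReachesIn

variable {C : Type*} {f : C → Option C} {a b c : C} {s t : ℕ}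

theorem refl (a : C) : ReachesIn f a a 0 := ⟨0, le_rfl, rfl⟩

theorem single (h : f a = some b) : ReachesIn f a b 1 := ⟨1, le_rfl, h⟩

theorem trans (h₁ : ReachesIn f a b s) (h₂ : ReachesIn f b c t) : ReachesIn f a c (s + t) := by
  obtain ⟨m, hm, h₁⟩ := h₁
  obtain ⟨n, hn, h₂⟩ := h₂
  exact ⟨n + m, by omega, by rw [Function.iterate_add_apply, h₁, h₂]⟩

theorem head (h₂ : ReachesIn f b c t) (h : f a = some b) : ReachesIn f a c (1 + t) :=
  (single h).trans h₂

theorem mono (h : ReachesIn f a b s) (hst : s ≤ t) : ReachesIn f a b t := by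
  obtain ⟨m, hm, h⟩ := h
  exact ⟨m, hm.trans hst, h⟩

end ReachesIn

/-- Structured programs acting on a family of stacks. `pop k p q` pops stack `k` and continues with
`p` if it was empty, with `q a` if the symbol `a` was popped. `loop k exits q` keeps popping stack `k`
and executing `q a` for the popped symbol `a`, until the stack is empty or a symbol satisfying `exits`
has been popped. -/
inductive StackProg {K : Type} (Γ : K → Type) : Type
  | skip : StackProg Γ
  | push (k : K) (x : Γ k) : StackProg Γ
  | seq (p q : StackProg Γ) : StackProg Γ
  | pop (k : K) (p : StackProg Γ) (q : Γ k → StackProg Γ) : StackProg Γ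
  | loop (k : K) (exits : Γ k → Bool) (q : Γ k → StackProg Γ) : StackProg Γ

namespace StackProg

variable {K : Type} {Γ : K → Type}

/-- The labels of the machine that executes a program. -/
def Lab : StackProg Γ → Type
  | skip => Unit
  | push _ _ => Unit
  | seq p q => Lab p ⊕ Lab q
  | pop k p q => Option (Lab p ⊕ (a : Γ k) × Lab (q a))
  | loop k _ q => Option ((a : Γ k) × Lab (q a))

theorem finite_lab [∀ k, Finite (Γ k)] : ∀ p : StackProg Γ, Finite (Lab p)
  | skip => inferInstanceAs (Finite Unit)
  | push _ _ => inferInstanceAs (Finite Unit)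
  | seq p q =>
    have := finite_lab p
    have := finite_lab q
    inferInstanceAs (Finite (Lab p ⊕ Lab q))
  | pop k p q =>
    have := finite_lab p
    have := fun a => finite_lab (q a)
    inferInstanceAs (Finite (Option (Lab p ⊕ (a : Γ k) × Lab (q a))))
  | loop k _ q =>
    have := fun a => finite_lab (q a)
    inferInstanceAs (Finite (Option ((a : Γ k) × Lab (q a))))

/-- The label at which the execution of a program starts. -/
def entry : (p : StackProg Γ) → Lab p
  | skip => ()
  | push _ _ => ()
  | seq p _ => Sum.inl (entry p)
  | pop _ _ _ => none
  | loop _ _ _ => none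

variable [DecidableEq K]

/-- The statements of the machine that executes a program as a part of a machine with labels `L`,
the labels of the program being embedded by `e`; the execution ends at the label `ex`. -/
def code {L : Type} : (p : StackProg Γ) → (Lab p → L) → L → Lab p →
    TM2.Stmt Γ L (Option ((k : K) × Γ k))
  | skip, _, ex, _ => .goto fun _ => ex
  | push k x, _, ex, _ => .push k (fun _ => x) (.goto fun _ => ex)
  | seq p q, e, ex, l =>
    match l with
    | Sum.inl l => code p (e ∘ Sum.inl) (e (Sum.inr (entry q))) l
    | Sum.inr l => code q (e ∘ Sum.inr) ex l
  | pop k p q, e, ex, l =>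
    match l with
    -- The popped symbol is kept in the internal state, tagged with its stack because its type
    -- depends on the stack. The final `ex` only makes the function total: the tag is always `k`
    -- here.
    | none => .pop k (fun _ o => o.map (Sigma.mk k)) (.goto fun v =>
        v.elim (e (some (Sum.inl (entry p)))) fun s =>
          if h : s.1 = k then e (some (Sum.inr ⟨h ▸ s.2, entry (q (h ▸ s.2))⟩)) else ex)
    | some (Sum.inl l) => code p (fun l => e (some (Sum.inl l))) ex l
    | some (Sum.inr ⟨a, l⟩) => code (q a) (fun l => e (some (Sum.inr ⟨a, l⟩))) ex l
  | loop k exits q, e, ex, l =>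
    match l with
    | none => .pop k (fun _ o => o.map (Sigma.mk k)) (.goto fun v =>
        v.elim ex fun s =>
          if h : s.1 = k then
            if exits (h ▸ s.2) then ex else e (some ⟨h ▸ s.2, entry (q (h ▸ s.2))⟩)
          else ex)
    | some ⟨a, l⟩ => code (q a) (fun l => e (some ⟨a, l⟩)) (e none) l

/-- `Runs p S S' t`: started with the stacks `S`, the program `p` ends with the stacks `S'`, after
at most `t` steps. -/
def Runs (p : StackProg Γ) (S S' : ∀ k, List (Γ k)) (t : ℕ) : Prop :=
  -- Every host machine containing the code of `p` is allowed, so that the parts of a composite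
  -- program can be run in place. The internal state is arbitrary before and unspecified after.
  ∀ (L : Type) (M : L → TM2.Stmt Γ L (Option ((k : K) × Γ k))) (e : Lab p → L) (ex : L),
    (∀ l, M (e l) = code p e ex l) → ∀ v, ∃ v',
      ReachesIn (TM2.step M) ⟨some (e (entry p)), v, S⟩ ⟨some ex, v', S'⟩ t

variable {p : StackProg Γ} {S S₁ S' : ∀ k, List (Γ k)} {s t : ℕ} {k : K}

theorem Runs.mono (h : Runs p S S' s) (hst : s ≤ t) : Runs p S S' t := fun L M e ex hM v =>
  (h L M e ex hM v).imp fun _ h => h.mono hst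

theorem Runs.skip (S : ∀ k, List (Γ k)) : Runs skip S S 1 := fun L M e ex hM v =>
  ⟨v, .single (by simp [hM, code])⟩

theorem Runs.push (S : ∀ k, List (Γ k)) (k : K) (x : Γ k) :
    Runs (push k x) S (Function.update S k (x :: S k)) 1 := fun L M e ex hM v =>
  ⟨v, .single (by simp [hM, code])⟩

theorem Runs.seq {q : StackProg Γ} (hp : Runs p S S₁ s) (hq : Runs q S₁ S' t) :
    Runs (seq p q) S S' (s + t) := fun L M e ex hM v => by
  obtain ⟨v₁, h₁⟩ := hp L M (e ∘ Sum.inl) (e (Sum.inr (entry q))) (fun l => hM (Sum.inl l)) v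
  obtain ⟨v₂, h₂⟩ := hq L M (e ∘ Sum.inr) ex (fun l => hM (Sum.inr l)) v₁
  exact ⟨v₂, h₁.trans h₂⟩

theorem Runs.pop_cons {q : Γ k → StackProg Γ} {a : Γ k} {l : List (Γ k)} (hk : S k = a :: l)
    (hq : Runs (q a) (Function.update S k l) S' t) : Runs (pop k p q) S S' (1 + t) :=
  fun L M e ex hM v => by
  obtain ⟨v₁, h₁⟩ := hq L M (fun l => e (some (Sum.inr ⟨a, l⟩))) ex
    (fun l => hM (some (Sum.inr ⟨a, l⟩))) (some ⟨k, a⟩)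
  exact ⟨v₁, h₁.head ((congrArg (fun q => some (TM2.stepAux q v S)) (hM none)).trans
    (by simp [code, hk]))⟩

theorem Runs.loop_nil {exits : Γ k → Bool} {q : Γ k → StackProg Γ} (hk : S k = []) :
    Runs (loop k exits q) S S 1 := fun L M e ex hM v => by
  have : Function.update S k [] = S := by rw [← hk, Function.update_eq_self]
  exact ⟨none, .single ((congrArg (fun q => some (TM2.stepAux q v S)) (hM none)).trans
    (by simp [code, hk, this]))⟩

theorem Runs.loop_stop {exits : Γ k → Bool} {q : Γ k → StackProg Γ} {a : Γ k} {l : List (Γ k)}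
    (hk : S k = a :: l) (ha : exits a = true) :
    Runs (loop k exits q) S (Function.update S k l) 1 := fun L M e ex hM v =>
  ⟨some ⟨k, a⟩, .single ((congrArg (fun q => some (TM2.stepAux q v S)) (hM none)).trans
    (by simp [code, hk, ha]))⟩

theorem Runs.loop_cons {exits : Γ k → Bool} {q : Γ k → StackProg Γ} {a : Γ k} {l : List (Γ k)}
    (hk : S k = a :: l) (ha : exits a = false) (hq : Runs (q a) (Function.update S k l) S₁ s)
    (hl : Runs (loop k exits q) S₁ S' t) :
    Runs (loop k exits q) S S' (1 + (s + t)) := fun L M e ex hM v => by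
  obtain ⟨v₁, h₁⟩ := hq L M (fun l => e (some ⟨a, l⟩)) (e none)
    (fun l => hM (some ⟨a, l⟩)) (some ⟨k, a⟩)
  obtain ⟨v₂, h₂⟩ := hl L M e ex hM v₁
  exact ⟨v₂, (h₁.trans h₂).head ((congrArg (fun q => some (TM2.stepAux q v S)) (hM none)).trans
    (by simp [code, hk, ha]))⟩

/-- The machine that executes a program and then halts, with input stack `k₀` and output stack
`k₁`. -/
noncomputable def machine [Fintype K] [∀ k, Fintype (Γ k)] (p : StackProg Γ) (k₀ k₁ : K) :
    FinTM2 :=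
  have := finite_lab p
  { K := K
    k₀ := k₀
    k₁ := k₁
    Γ := Γ
    Λ := Option (Lab p)
    main := some (entry p)
    ΛFin := Fintype.ofFinite _
    σ := Option ((k : K) × Γ k)
    initialState := none
    -- A halting configuration must carry the initial internal state, so the state is reset first;
    -- this is the additional step in `machine_outputs`.
    m := fun l => l.elim (.load (fun _ => none) .halt) (code p some none) }

/-- A program that turns the stacks with input `x` into the stacks with output `y`, all the other
stacks being empty before and after. -/
theorem machine_outputs [Fintype K] [∀ k, Fintype (Γ k)] {k₀ k₁ : K}
    {x : List (Γ k₀)} {y : List (Γ k₁)}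
    (h : Runs p (Function.update (fun _ => []) k₀ x) (Function.update (fun _ => []) k₁ y) t) :
    Nonempty (TM2OutputsInTime (machine p k₀ k₁) x (some y) (t + 1)) := by
  -- The initial and halting configurations describe the stacks by casts along equalities of stack
  -- names; these are the same as updates of empty stacks.
  have hu : ∀ (k' : K) (z : List (Γ k')), (fun k => @dite (List (Γ k)) (k = k')
      (inferInstance) (fun h => by rw [h]; exact z) fun _ => []) =
      Function.update (fun _ => []) k' z := by
    intro k' z
    funext k
    by_cases hk : k = k'
    · subst hk; simp
    · simp [hk]
  obtain ⟨v, h⟩ := h (Option (Lab p)) (machine p k₀ k₁).m some none (fun l => rfl) none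
  have h' := h.trans (ReachesIn.single (b := ⟨none, none, Function.update (fun _ => []) k₁ y⟩) rfl)
  obtain ⟨s, hs, h'⟩ := h'
  refine ⟨⟨⟨s, ?_⟩, hs⟩⟩
  simp only [initList]
  have e₀ := hu k₀ x
  have e₁ := hu k₁ y
  refine Eq.trans ?_ (h'.trans ?_)
  · congr 3
  · congr 2
    exact e₁.symm

end StackProg

/-! ### Binary trees on stacks and the basic programs handling them -/

/-- Binary trees, the data on which programs operate. -/
inductive Data : Type
  | nil : Data
  | cons (x y : Data) : Data

namespace Data

/-- The preorder code of a tree. -/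
def code : Data → List Bool
  | nil => [false]
  | cons x y => true :: (code x ++ code y)

/-- The number of nodes of a tree, counting the leaves. -/
def size : Data → ℕ
  | nil => 1
  | cons x y => 1 + size x + size y

@[simp]
theorem length_code (x : Data) : x.code.length = x.size := by
  induction x with
  | nil => rfl
  | cons x y hx hy => simp [code, size, hx, hy]; omega

theorem one_le_size (x : Data) : 1 ≤ x.size := by
  cases x <;> simp [size]; omega

end Data

/-- The names of the working stacks. -/
inductive Reg : Type
  | a | b | c | d
  deriving DecidableEq

instance : Fintype Reg := ⟨{.a, .b, .c, .d}, fun r => by cases r <;> decide⟩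

/-- The names of the stacks. -/
inductive Stk : Type
  | inp | out
  | reg (r : Reg)
  deriving DecidableEq

instance : Fintype Stk :=
  ⟨{.inp, .out, .reg .a, .reg .b, .reg .c, .reg .d}, fun k => by
    rcases k with _ | _ | _ | _ | _ | _ <;> decide⟩

/-- The alphabets of the stacks. -/
abbrev Alph : Stk → Type
  | .inp => Bool ⊕ Bool
  | .out => Bool
  | .reg _ => Bool

instance : ∀ k, Fintype (Alph k)
  | .inp => inferInstanceAs (Fintype (Bool ⊕ Bool))
  | .out => inferInstanceAs (Fintype Bool)
  | .reg _ => inferInstanceAs (Fintype Bool)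

/-- The contents of all stacks, from those of the input stack, the output stack and the working
stacks. -/
def tapes (i : List (Bool ⊕ Bool)) (o : List Bool) (R : Reg → List Bool) : ∀ k, List (Alph k)
  | .inp => i
  | .out => o
  | .reg r => R r

/-- The contents of the working stacks, listed. -/
def regs (a b c d : List Bool) : Reg → List Bool
  | .a => a
  | .b => b
  | .c => c
  | .d => d

section

variable (i i' : List (Bool ⊕ Bool)) (o o' : List Bool) (R : Reg → List Bool) (r : Reg)
  (a b c d l : List Bool)

@[simp]
theorem tapes_reg : tapes i o R (.reg r) = R r := rfl

@[simp]
theorem update_tapes_inp : Function.update (tapes i o R) .inp i' = tapes i' o R := by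
  funext k; cases k <;> simp [tapes]

@[simp]
theorem update_tapes_out : Function.update (tapes i o R) .out o' = tapes i o' R := by
  funext k; cases k <;> simp [tapes]

@[simp]
theorem update_tapes_reg :
    Function.update (tapes i o R) (.reg r) l = tapes i o (Function.update R r l) := by
  funext k
  cases k with
  | inp => simp [tapes]
  | out => simp [tapes]
  | reg r' => by_cases h : r' = r <;> [subst h; skip] <;> simp [tapes, *]

@[simp]
theorem update_regs_a : Function.update (regs a b c d) .a l = regs l b c d := by
  funext k; cases k <;> simp [regs]

@[simp]
theorem update_regs_b : Function.update (regs a b c d) .b l = regs a l c d := by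
  funext k; cases k <;> simp [regs]

@[simp]
theorem update_regs_c : Function.update (regs a b c d) .c l = regs a b l d := by
  funext k; cases k <;> simp [regs]

@[simp]
theorem update_regs_d : Function.update (regs a b c d) .d l = regs a b c l := by
  funext k; cases k <;> simp [regs]

@[simp] theorem regs_a : regs a b c d .a = a := rfl
@[simp] theorem regs_b : regs a b c d .b = b := rfl
@[simp] theorem regs_c : regs a b c d .c = c := rfl
@[simp] theorem regs_d : regs a b c d .d = d := rfl

end

namespace StackProg

/-- Move the symbols of a working stack to another one, reversing their order. -/
def pour (r r' : Reg) : StackProg Alph :=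
  loop (.reg r) (fun _ => false) fun x => push (.reg r') x

theorem runs_pour {r r' : Reg} (hr : r ≠ r') (i : List (Bool ⊕ Bool)) (o l : List Bool)
    (R : Reg → List Bool) (hl : R r = l) :
    Runs (pour r r') (tapes i o R)
      (tapes i o (Function.update (Function.update R r []) r' (l.reverse ++ R r')))
      (2 * l.length + 1) := by
  induction l generalizing R with
  | nil =>
    have : Function.update (Function.update R r []) r' (R r') = R := by
      rw [← hl, Function.update_eq_self, Function.update_eq_self]
    simpa [pour, this] using Runs.loop_nil (S := tapes i o R) (k := Stk.reg r) hl
  | cons x l ih =>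
    have h := ih (Function.update (Function.update R r l) r' (x :: R r')) (by simp [hr])
    have h₁ := Runs.push (tapes i o (Function.update R r l)) (.reg r') x
    have h₂ := Runs.loop_cons (S := tapes i o R) (k := Stk.reg r) (a := x) (l := l)
      (exits := fun _ => false) (q := fun x => push (.reg r') x) hl rfl (by simpa using h₁)
      (by simpa [pour, hr.symm] using h)
    have e : Function.update (Function.update (Function.update (Function.update R r l) r'
        (x :: R r')) r []) r' (l.reverse ++ x :: R r') =
        Function.update (Function.update R r []) r' ((x :: l).reverse ++ R r') := by
      funext k
      by_cases h : k = r' <;> by_cases h' : k = r <;> simp [Function.update_apply, h, h']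
    rw [e] at h₂
    exact h₂.mono (by simp; omega)

/-- `Exec p l l' t`: started with the string `l` on stack `a` and all other stacks empty, `p` ends
with `l'` on stack `a` and all other stacks empty, after at most `t` steps. -/
def Exec (p : StackProg Alph) (l l' : List Bool) (t : ℕ) : Prop :=
  Runs p (tapes [] [] (regs l [] [] [])) (tapes [] [] (regs l' [] [] [])) t

variable {p q : StackProg Alph} {l l₁ l' : List Bool} {s t : ℕ}

theorem Exec.mono (h : Exec p l l' s) (hst : s ≤ t) : Exec p l l' t := Runs.mono h hst

theorem Exec.seq (hp : Exec p l l₁ s) (hq : Exec q l₁ l' t) : Exec (seq p q) l l' (s + t) :=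
  Runs.seq hp hq

theorem Exec.push (x : Bool) (l : List Bool) : Exec (push (.reg .a) x) l (x :: l) 1 := by
  simpa [Exec] using Runs.push (tapes [] [] (regs l [] [] [])) (.reg .a) x

theorem Exec.skip (l : List Bool) : Exec skip l l 1 := Runs.skip _

/-- Pop a symbol off stack `a` and branch according to it. -/
def test (p q : StackProg Alph) : StackProg Alph :=
  pop (.reg .a) skip fun x => if x then p else q

theorem Exec.test_true (h : Exec p l l' t) : Exec (test p q) (true :: l) l' (1 + t) :=
  Runs.pop_cons (a := true) rfl (by simpa [Exec] using h)

theorem Exec.test_false (h : Exec q l l' t) : Exec (test p q) (false :: l) l' (1 + t) :=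
  Runs.pop_cons (a := false) rfl (by simpa [Exec] using h)

/-- Put a string on stack `a`. -/
def pushList : List Bool → StackProg Alph
  | [] => skip
  | x :: l => seq (pushList l) (push (.reg .a) x)

theorem runs_pushList (i : List (Bool ⊕ Bool)) (o l a b c d : List Bool) :
    Runs (pushList l) (tapes i o (regs a b c d)) (tapes i o (regs (l ++ a) b c d))
      (l.length + 1) := by
  induction l with
  | nil => exact Runs.skip _
  | cons x l ih =>
    exact ih.seq (by simpa using Runs.push (tapes i o (regs (l ++ a) b c d)) (.reg .a) x)

theorem exec_pushList (l r : List Bool) : Exec (pushList l) r (l ++ r) (l.length + 1) :=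
  runs_pushList [] [] l r [] [] []

/-- Move the code of a tree from stack `a` to stack `b`, reversed. Stack `c` counts the subtrees that
are still to be moved. -/
def take : StackProg Alph :=
  seq (push (.reg .c) true) (loop (.reg .c) (fun _ => false) fun _ =>
    pop (.reg .a) skip fun x =>
      if x then seq (push (.reg .b) true) (seq (push (.reg .c) true) (push (.reg .c) true))
      else push (.reg .b) false)

/-- Each round consumes one mark on `c`; an inner node puts back two, a leaf none, so the marks
count exactly the subtrees missing from the preorder code. The continuation `h` starts after the
move of the whole tree, which lets the inductive hypotheses for the two subtrees be chained. -/
theorem runs_take_aux (x : Data) (a b c d : List Bool) {S} {t : ℕ}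
    (h : Runs (loop (.reg .c) (fun _ => false) fun _ =>
      pop (.reg .a) skip fun x =>
        if x then seq (push (.reg .b) true) (seq (push (.reg .c) true) (push (.reg .c) true))
        else push (.reg .b) false) (tapes [] [] (regs a (x.code.reverse ++ b) c d)) S t) :
    Runs (loop (.reg .c) (fun _ => false) fun _ =>
      pop (.reg .a) skip fun x =>
        if x then seq (push (.reg .b) true) (seq (push (.reg .c) true) (push (.reg .c) true))
        else push (.reg .b) false) (tapes [] [] (regs (x.code ++ a) b (true :: c) d)) S
        (5 * x.size + t) := by
  induction x generalizing a b c t with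
  | nil =>
    refine (Runs.loop_cons (k := Stk.reg .c) (a := true) (l := c) rfl rfl
      (Runs.pop_cons (k := Stk.reg .a) (a := false) (l := a) rfl ?_) h).mono
      (s := 1 + ((1 + 1) + t)) ?_
    · simpa [Data.code] using Runs.push (tapes [] [] (regs a b c d)) (.reg .b) false
    · simp [Data.size]; omega
  | cons x y hx hy =>
    have h₁ := hy a (x.code.reverse ++ true :: b) c (by simpa [Data.code] using h)
    have h₂ := hx (y.code ++ a) (true :: b) (true :: c) h₁
    refine (Runs.loop_cons (k := Stk.reg .c) (a := true) (l := c) rfl rfl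
      (Runs.pop_cons (k := Stk.reg .a) (a := true) (l := x.code ++ (y.code ++ a))
        (by simp [Data.code]) ?_) h₂).mono
      (s := 1 + ((1 + (1 + (1 + 1))) + (5 * x.size + (5 * y.size + t)))) ?_
    · have e₁ := Runs.push (tapes [] [] (regs (x.code ++ (y.code ++ a)) b c d)) (.reg .b) true
      have e₂ := Runs.push (tapes [] [] (regs (x.code ++ (y.code ++ a)) (true :: b) c d))
        (.reg .c) true
      have e₃ := Runs.push (tapes [] [] (regs (x.code ++ (y.code ++ a)) (true :: b) (true :: c) d))
        (.reg .c) true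
      simp at e₁ e₂ e₃
      simpa using e₁.seq (e₂.seq e₃)
    · simp [Data.size]; omega

theorem runs_take (x : Data) (a b d : List Bool) :
    Runs take (tapes [] [] (regs (x.code ++ a) b [] d))
      (tapes [] [] (regs a (x.code.reverse ++ b) [] d)) (5 * x.size + 2) := by
  have h₁ := Runs.push (tapes [] [] (regs (x.code ++ a) b [] d)) (.reg .c) true
  simp at h₁
  exact (h₁.seq (runs_take_aux x a b [] d (Runs.loop_nil rfl))).mono (by omega)

/-- Remove a tree from stack `a`. -/
def drop : StackProg Alph := seq take (loop (.reg .b) (fun _ => false) fun _ => skip)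

theorem exec_drop (x : Data) (r : List Bool) : Exec drop (x.code ++ r) r (7 * x.size + 3) := by
  have h : ∀ l, Runs (loop (.reg .b) (fun _ => false) fun _ => skip)
      (tapes [] [] (regs r l [] [])) (tapes [] [] (regs r [] [] [])) (2 * l.length + 1) := by
    intro l
    induction l with
    | nil => exact Runs.loop_nil rfl
    | cons y l ih =>
      refine (Runs.loop_cons (k := Stk.reg .b) (a := y) (l := l) rfl rfl ?_ ih).mono
        (s := 1 + (1 + (2 * l.length + 1))) (by simp; omega)
      simpa using Runs.skip (tapes [] [] (regs r l [] []))
  refine ((runs_take x r [] []).seq (h _)).mono ?_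
  simp; omega

/-- Duplicate the tree on the top of stack `a`. -/
def dup : StackProg Alph :=
  seq take (seq (loop (.reg .b) (fun _ => false) fun x => seq (push (.reg .a) x) (push (.reg .d) x))
    (seq (pour .d .b) (pour .b .a)))

theorem exec_dup (x : Data) (r : List Bool) :
    Exec dup (x.code ++ r) (x.code ++ (x.code ++ r)) (12 * x.size + 5) := by
  have h : ∀ l a d, Runs (loop (.reg .b) (fun _ => false) fun x =>
      seq (push (.reg .a) x) (push (.reg .d) x))
      (tapes [] [] (regs a l [] d)) (tapes [] [] (regs (l.reverse ++ a) [] [] (l.reverse ++ d)))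
      (3 * l.length + 1) := by
    intro l
    induction l with
    | nil => exact fun a d => Runs.loop_nil rfl
    | cons y l ih =>
      intro a d
      refine (Runs.loop_cons (k := Stk.reg .b) (a := y) (l := l) rfl rfl ?_
        (by simpa using ih (y :: a) (y :: d))).mono
        (s := 1 + ((1 + 1) + (3 * l.length + 1))) (by simp; omega)
      have e₁ := Runs.push (tapes [] [] (regs a l [] d)) (.reg .a) y
      have e₂ := Runs.push (tapes [] [] (regs (y :: a) l [] d)) (.reg .d) y
      simp at e₁ e₂
      simpa using e₁.seq e₂
  have h₁ := h x.code.reverse r []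
  have h₂ := runs_pour (r := .d) (r' := .b) (by decide) [] [] x.code
    (regs (x.code ++ r) [] [] x.code) rfl
  have h₃ := runs_pour (r := .b) (r' := .a) (by decide) [] [] x.code.reverse
    (regs (x.code ++ r) x.code.reverse [] []) rfl
  simp at h₁ h₂ h₃
  refine Runs.mono ((runs_take x r [] []).seq ((by simpa using h₁ :
    Runs _ _ (tapes [] [] (regs (x.code ++ r) [] [] x.code)) _).seq (h₂.seq h₃))) ?_
  omega

/-- Swap the two topmost trees of stack `a`. -/
def swap : StackProg Alph :=
  seq take (seq (pour .b .d) (seq take (seq (pour .d .c) (seq (pour .c .a) (pour .b .a)))))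

theorem exec_swap (x y : Data) (r : List Bool) :
    Exec swap (x.code ++ (y.code ++ r)) (y.code ++ (x.code ++ r))
      (11 * x.size + 7 * y.size + 8) := by
  have h₁ := runs_pour (r := .b) (r' := .d) (by decide) [] [] x.code.reverse
    (regs (y.code ++ r) x.code.reverse [] []) rfl
  have h₂ := runs_pour (r := .d) (r' := .c) (by decide) [] [] x.code
    (regs r y.code.reverse [] x.code) rfl
  have h₃ := runs_pour (r := .c) (r' := .a) (by decide) [] [] x.code.reverse
    (regs r y.code.reverse x.code.reverse []) rfl
  have h₄ := runs_pour (r := .b) (r' := .a) (by decide) [] [] y.code.reverse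
    (regs (x.code ++ r) y.code.reverse [] []) rfl
  have t₁ := runs_take x (y.code ++ r) [] []
  have t₂ := runs_take y r [] x.code
  simp at h₁ h₂ h₃ h₄ t₁ t₂
  exact Runs.mono (t₁.seq (h₁.seq (t₂.seq (h₂.seq (h₃.seq h₄))))) (by omega)

/-- `p` replaces the tree `x` on the top of stack `a` by the tree `y`, in at most `t` steps. -/
def Computes (p : StackProg Alph) (x y : Data) (t : ℕ) : Prop :=
  ∀ r, Exec p (x.code ++ r) (y.code ++ r) t

/-- Given a list (a right comb) and a tree on stack `a`, execute `p` on the tree as often as the list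
has entries. -/
def iter (p : StackProg Alph) : StackProg Alph :=
  -- A popped `true` is the root of a cons cell: its head is dropped and its tail swapped behind the
  -- tree, so that `p` finds its argument on top. A popped `false` is the empty list.
  loop (.reg .a) (fun x => !x) fun _ => seq drop (seq swap (seq p swap))

end StackProg

/-! ### Tree encodings, polynomial bounds and polynomial-time functions -/

/-- A representation of the elements of a type by binary trees. -/
class DataEnc (α : Type) where
  /-- The tree that represents an element. -/
  enc : α → Data

open DataEnc StackProg

/-- The size of the representation of an element. -/
def encSize {α : Type} [DataEnc α] (x : α) : ℕ := (enc x).size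

instance : DataEnc Unit := ⟨fun _ => .nil⟩

instance : DataEnc Bool := ⟨fun b => if b then .cons .nil .nil else .nil⟩

instance : DataEnc ℕ := ⟨fun n => Nat.rec .nil (fun _ x => .cons .nil x) n⟩

section

variable {α β γ δ : Type} [DataEnc α] [DataEnc β] [DataEnc γ] [DataEnc δ]

instance : DataEnc (α × β) := ⟨fun p => .cons (enc p.1) (enc p.2)⟩

instance : DataEnc (List α) := ⟨fun l => l.foldr (fun x y => .cons (enc x) y) .nil⟩

theorem one_le_encSize (x : α) : 1 ≤ encSize x := Data.one_le_size _

@[simp]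
theorem encSize_pair (x : α) (y : β) : encSize (x, y) = 1 + encSize x + encSize y := rfl

@[simp]
theorem encSize_nil : encSize ([] : List α) = 1 := rfl

@[simp]
theorem encSize_cons (x : α) (l : List α) : encSize (x :: l) = 1 + encSize x + encSize l := rfl

@[simp]
theorem encSize_nat (n : ℕ) : encSize n = 2 * n + 1 := by
  induction n with
  | zero => rfl
  | succ n ih =>
    have : encSize (n + 1) = 1 + 1 + encSize n := rfl
    omega

theorem encSize_append (l l' : List α) : encSize (l ++ l') + 1 = encSize l + encSize l' := by
  induction l with
  | nil => simp; omega
  | cons x l ih => simp; omega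

theorem length_le_encSize (l : List α) : l.length ≤ encSize l := by
  induction l with
  | nil => simp
  | cons x l ih => simp; omega

theorem encSize_le_of_mem {x : α} {l : List α} (h : x ∈ l) : encSize x ≤ encSize l := by
  induction l with
  | nil => simp at h
  | cons y l ih =>
    rcases List.mem_cons.1 h with rfl | h
    · simp; omega
    · have := ih h
      simp; omega

theorem encSize_le_of_forall {l : List α} {m : ℕ} (h : ∀ x ∈ l, encSize x ≤ m) :
    encSize l ≤ 1 + l.length * (1 + m) := by
  induction l with
  | nil => simp
  | cons y l ih =>
    have h₁ := ih fun x hx => h x (List.mem_cons_of_mem _ hx)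
    have h₂ := h y List.mem_cons_self
    simp [add_mul]; omega

theorem encSize_le_of_sublist {l l' : List α} (h : List.Sublist l l') :
    encSize l ≤ encSize l' := by
  induction h with
  | slnil => rfl
  | cons x _ ih => simp; omega
  | cons_cons x _ ih => simp; omega

theorem polynomial_eval_mono (P : Polynomial ℕ) {m n : ℕ} (h : m ≤ n) : P.eval m ≤ P.eval n := by
  rw [Polynomial.eval_eq_sum_range, Polynomial.eval_eq_sum_range]
  gcongr

/-- A function with values in the natural numbers is polynomially bounded in the size of the
argument. -/
def PolyBdd (g : α → ℕ) : Prop := ∃ P : Polynomial ℕ, ∀ x, g x ≤ P.eval (encSize x)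

namespace PolyBdd

variable {g h : α → ℕ}

theorem mono (hh : PolyBdd h) (hgh : ∀ x, g x ≤ h x) : PolyBdd g :=
  hh.imp fun _ hP x => (hgh x).trans (hP x)

theorem const (n : ℕ) : PolyBdd fun _ : α => n := ⟨Polynomial.C n, fun x => by simp⟩

theorem encSize : PolyBdd fun x : α => encSize x := ⟨Polynomial.X, fun x => by simp⟩

theorem add (hg : PolyBdd g) (hh : PolyBdd h) : PolyBdd fun x => g x + h x := by
  obtain ⟨P, hP⟩ := hg
  obtain ⟨Q, hQ⟩ := hh
  exact ⟨P + Q, fun x => by simpa using add_le_add (hP x) (hQ x)⟩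

theorem mul (hg : PolyBdd g) (hh : PolyBdd h) : PolyBdd fun x => g x * h x := by
  obtain ⟨P, hP⟩ := hg
  obtain ⟨Q, hQ⟩ := hh
  exact ⟨P * Q, fun x => by simpa using mul_le_mul' (hP x) (hQ x)⟩

theorem eval (P : Polynomial ℕ) (hg : PolyBdd g) : PolyBdd fun x => P.eval (g x) := by
  obtain ⟨Q, hQ⟩ := hg
  exact ⟨P.comp Q, fun x => by simpa using polynomial_eval_mono P (hQ x)⟩

theorem comp {g : β → ℕ} {f : α → β} (hg : PolyBdd g) (hf : PolyBdd fun x => _root_.encSize (f x)) :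
    PolyBdd fun x => g (f x) := by
  obtain ⟨P, hP⟩ := hg
  exact (hf.eval P).mono fun x => hP (f x)

end PolyBdd

/-- A function is computed by a stack program in polynomial time. -/
@[fun_prop]
def PolyTime (f : α → β) : Prop :=
  -- The bound on the size of the value is what makes running times of compositions polynomial.
  ∃ (p : StackProg Alph) (t : α → ℕ), PolyBdd t ∧ PolyBdd (fun x => encSize (f x)) ∧
    ∀ x, Computes p (enc x) (enc (f x)) (t x)

namespace PolyTime

theorem polyBdd {f : α → β} (hf : PolyTime f) : PolyBdd fun x => encSize (f x) :=
  hf.choose_spec.choose_spec.2.1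

/-- Nothing has to be computed when only the type changes and the tree does not. A pair of head and
tail has the tree of the list, and a number the tree of a list of units. -/
theorem of_enc_eq {f : α → β} (h : ∀ x, enc (f x) = enc x) : PolyTime f :=
  ⟨skip, fun _ => 1, .const 1, PolyBdd.encSize.mono fun x => by simp [encSize, h], fun x r => by
    rw [h]; exact Exec.skip _⟩

@[fun_prop]
protected theorem id : PolyTime fun x : α => x := of_enc_eq fun _ => rfl

@[fun_prop]
theorem comp {f : β → γ} {g : α → β} (hf : PolyTime f) (hg : PolyTime g) :
    PolyTime fun x => f (g x) := by
  obtain ⟨p, s, hs, hf', hp⟩ := hf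
  obtain ⟨q, t, ht, hg', hq⟩ := hg
  exact ⟨seq q p, fun x => t x + s (g x), ht.add (hs.comp hg'), hf'.comp hg',
    fun x r => (hq x r).seq (hp (g x) r)⟩

@[fun_prop]
theorem const (y : β) : PolyTime fun _ : α => y := by
  refine ⟨seq drop (pushList (enc y).code), fun x => 7 * encSize x + 3 + ((enc y).code.length + 1),
    (((PolyBdd.const 7).mul .encSize).add (.const 3)).add (.const _), .const _, fun x r => ?_⟩
  exact (exec_drop _ _).seq (exec_pushList _ _)

@[fun_prop]
theorem pair {f : α → β} {g : α → γ} (hf : PolyTime f) (hg : PolyTime g) :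
    PolyTime fun x => (f x, g x) := by
  obtain ⟨p, s, hs, hf', hp⟩ := hf
  obtain ⟨q, t, ht, hg', hq⟩ := hg
  refine ⟨seq dup (seq p (seq swap (seq q (seq swap (push (.reg .a) true))))),
    fun x => (12 * encSize x + 5) + (s x + ((11 * encSize (f x) + 7 * encSize x + 8) + (t x +
      ((11 * encSize (g x) + 7 * encSize (f x) + 8) + 1)))), ?_, ?_, fun x r => ?_⟩
  · exact (((PolyBdd.const 12).mul .encSize).add (.const 5)).add <| hs.add <|
      ((((PolyBdd.const 11).mul hf').add ((PolyBdd.const 7).mul .encSize)).add (.const 8)).add <|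
      ht.add <|
      ((((PolyBdd.const 11).mul hg').add ((PolyBdd.const 7).mul hf')).add (.const 8)).add (.const 1)
  · exact ((PolyBdd.const 1).add hf').add hg'
  · have h := (exec_dup (enc x) r).seq <| (hp x _).seq <| (exec_swap _ _ _).seq <| (hq x _).seq <|
      (exec_swap _ _ _).seq (.push true _)
    simpa [enc, Data.code, encSize] using h

theorem prod_fst : PolyTime (Prod.fst : α × β → α) := by
  refine ⟨test (seq swap drop) skip, fun x => 1 + ((11 * encSize x + 7 * encSize x + 8) +
    (7 * encSize x + 3)), ?_, PolyBdd.encSize.mono fun x => ?_, fun x r => ?_⟩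
  · exact (PolyBdd.const 1).add (((((PolyBdd.const 11).mul .encSize).add
      ((PolyBdd.const 7).mul .encSize)).add (.const 8)).add
      (((PolyBdd.const 7).mul .encSize).add (.const 3)))
  · obtain ⟨x, y⟩ := x
    simp; omega
  · obtain ⟨x, y⟩ := x
    have h := Exec.test_true (q := skip) <| (exec_swap (enc x) (enc y) r).seq (exec_drop _ _)
    refine Exec.mono (by simpa [enc, Data.code] using h) ?_
    simp [encSize, enc, Data.size]; omega

theorem prod_snd : PolyTime (Prod.snd : α × β → β) := by
  refine ⟨test drop skip, fun x => 1 + (7 * encSize x + 3), ?_,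
    PolyBdd.encSize.mono fun x => ?_, fun x r => ?_⟩
  · exact (PolyBdd.const 1).add (((PolyBdd.const 7).mul .encSize).add (.const 3))
  · obtain ⟨x, y⟩ := x
    simp
  · obtain ⟨x, y⟩ := x
    have h := Exec.test_true (q := skip) <| exec_drop (enc x) ((enc y).code ++ r)
    refine Exec.mono (by simpa [enc, Data.code] using h) ?_
    simp [encSize, enc, Data.size]; omega

@[fun_prop]
theorem fst {f : α → β × γ} (hf : PolyTime f) : PolyTime fun x => (f x).1 := prod_fst.comp hf

@[fun_prop]
theorem snd {f : α → β × γ} (hf : PolyTime f) : PolyTime fun x => (f x).2 := prod_snd.comp hf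

@[fun_prop]
theorem cond {c : α → Bool} {f g : α → β} (hc : PolyTime c) (hf : PolyTime f) (hg : PolyTime g) :
    PolyTime fun x => bif c x then f x else g x := by
  obtain ⟨p₀, t₀, ht₀, -, hp₀⟩ := hc
  obtain ⟨p₁, t₁, ht₁, hf', hp₁⟩ := hf
  obtain ⟨p₂, t₂, ht₂, hg', hp₂⟩ := hg
  -- `true` is the tree `cons nil nil`: after the test of its root two leaves remain to be dropped,
  -- at cost 10 each, whence the 20 below.
  refine ⟨seq dup (seq p₀ (test (seq drop (seq drop p₁)) p₂)),
    fun x => (12 * encSize x + 5) + (t₀ x + (1 + (20 + (t₁ x + t₂ x)))), ?_, ?_, fun x r => ?_⟩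
  · exact (((PolyBdd.const 12).mul .encSize).add (.const 5)).add (ht₀.add ((PolyBdd.const 1).add
      ((PolyBdd.const 20).add (ht₁.add ht₂))))
  · refine (hf'.add hg').mono fun x => ?_
    dsimp only
    cases c x <;> simp
  · refine (exec_dup (enc x) r).seq ((hp₀ x _).seq ?_)
    dsimp only
    cases c x with
    | false =>
      exact Exec.mono (s := 1 + t₂ x) (Exec.test_false (hp₂ x r)) (by omega)
    | true =>
      refine Exec.test_true (Exec.mono (s := (7 * 1 + 3) + ((7 * 1 + 3) + t₁ x)) ?_ (by omega))
      exact (exec_drop .nil _).seq ((exec_drop .nil _).seq (hp₁ x r))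

@[fun_prop]
theorem ite {c : α → Prop} [DecidablePred c] {f g : α → β} (hc : PolyTime fun x => decide (c x))
    (hf : PolyTime f) (hg : PolyTime g) : PolyTime fun x => if c x then f x else g x := by
  simpa [Bool.cond_decide] using hc.cond hf hg

end PolyTime

/-- Case distinction on lists. -/
def listCase (l : List α) (b : β) (f : α → List α → β) : β :=
  match l with
  | [] => b
  | x :: l => f x l

namespace PolyTime

@[fun_prop]
theorem cons {f : α → β} {g : α → List β} (hf : PolyTime f) (hg : PolyTime g) :
    PolyTime fun x => f x :: g x :=
  (of_enc_eq (f := fun p : β × List β => p.1 :: p.2) fun _ => rfl).comp (hf.pair hg)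

@[fun_prop]
theorem listCase {l : α → List β} {f : α → γ} {g : α → β → List β → γ} (hl : PolyTime l)
    (hf : PolyTime f) (hg : PolyTime fun p : (β × List β) × α => g p.2 p.1.1 p.1.2) :
    PolyTime fun x => listCase (l x) (f x) (g x) := by
  obtain ⟨p₀, t₀, ht₀, hl', hp₀⟩ := hl
  obtain ⟨p₁, t₁, ht₁, hf', hp₁⟩ := hf
  obtain ⟨p₂, t₂, ht₂, hg', hp₂⟩ := hg
  obtain ⟨P, hP⟩ := ht₂
  obtain ⟨Q, hQ⟩ := hg'
  have hb : PolyBdd fun x => 2 + encSize (l x) + encSize x :=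
    ((PolyBdd.const 2).add hl').add .encSize
  -- Once the root of a nonempty list is popped, head, tail and `x` lie on the stack in this order;
  -- pushing `true` twice turns them into the tree of `((head, tail), x)`, the argument expected by
  -- `p₂`.
  refine ⟨seq dup (seq p₀ (test (seq (push (.reg .a) true) (seq (push (.reg .a) true) p₂)) p₁)),
    fun x => (12 * encSize x + 5) + (t₀ x + (1 + (2 + (t₁ x + P.eval (2 + encSize (l x) + encSize x))))),
    ?_, ?_, fun x r => ?_⟩
  · exact (((PolyBdd.const 12).mul .encSize).add (.const 5)).add (ht₀.add ((PolyBdd.const 1).add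
      ((PolyBdd.const 2).add (ht₁.add (hb.eval P)))))
  · refine (hf'.add (hb.eval Q)).mono fun x => ?_
    dsimp only
    cases l x with
    | nil => simp [_root_.listCase]
    | cons y l' =>
      refine le_add_left ((hQ ((y, l'), x)).trans (polynomial_eval_mono Q ?_))
      simp
  · refine (exec_dup (enc x) r).seq ((hp₀ x _).seq ?_)
    dsimp only
    cases l x with
    | nil => exact Exec.mono (s := 1 + t₁ x) (Exec.test_false (hp₁ x r)) (by omega)
    | cons y l' =>
      have h := (Exec.push true _).seq ((Exec.push true _).seq (hp₂ ((y, l'), x) r))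
      have h' := Exec.test_true (q := p₁) h
      refine Exec.mono (s := 1 + (1 + (1 + t₂ ((y, l'), x))))
        (by simpa [enc, Data.code, _root_.listCase] using h') ?_
      have := (hP ((y, l'), x)).trans (polynomial_eval_mono P
        (n := 2 + encSize (y :: l') + encSize x) (by simp))
      omega

/-- A round drops one entry (at most 7L + 3), swaps twice (together at most 18L + 18B + 16), runs
`p` (at most τ) and takes one step for the loop. -/
theorem exec_iter {p : StackProg Alph} {f : γ → γ} {L B τ : ℕ} (r : List Bool) (l : List β) (s : γ)
    (hL : encSize l ≤ L) (hB : ∀ i ≤ l.length, encSize (f^[i] s) ≤ B)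
    (hp : ∀ i < l.length, Computes p (enc (f^[i] s)) (enc (f^[i + 1] s)) τ) :
    Exec (iter p) ((enc l).code ++ ((enc s).code ++ r)) ((enc (f^[l.length] s)).code ++ r)
      (l.length * (20 + 25 * L + 18 * B + τ) + 1) := by
  induction l generalizing s with
  | nil =>
    simpa [Exec, iter, enc, Data.code] using Runs.loop_stop
      (S := tapes [] [] (regs (false :: ((enc s).code ++ r)) [] [] []))
      (k := .reg .a) (exits := fun x => !x) (q := fun _ => seq drop (seq swap (seq p swap)))
      (a := false) rfl rfl
  | cons y l ih =>
    simp only [encSize_cons] at hL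
    have h := ih (f s) (by omega) (fun i hi => hB (i + 1) (by simpa using hi))
      (fun i hi => hp (i + 1) (by simpa using hi))
    have h₁ := (exec_drop (enc y) ((enc l).code ++ ((enc s).code ++ r))).seq <|
      (exec_swap _ _ _).seq <| (hp 0 (by simp) _).seq (exec_swap _ _ _)
    have h₂ := Runs.loop_cons (k := .reg .a) (exits := fun x => !x) (a := true)
      (S := tapes [] [] (regs ((enc (y :: l)).code ++ ((enc s).code ++ r)) [] [] []))
      (q := fun _ => seq drop (seq swap (seq p swap)))
      (by simp [enc, Data.code]; rfl) rfl (by simpa [enc, Data.code, Exec] using h₁) h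
    refine Exec.mono h₂ ?_
    have hB₀ := hB 0 (by simp)
    have hB₁ := hB 1 (by simp)
    simp only [Function.iterate_zero, id, Function.iterate_one, encSize] at hB₀ hB₁ hL
    simp only [List.length_cons, add_mul, one_mul]
    simp only [enc] at *
    omega

/-- Iterating a function, as often as a list has entries, if the iterates do not become too large. -/
theorem iterate {l : α → List β} {s : α → γ} {f : γ → γ} (hl : PolyTime l) (hs : PolyTime s)
    (hf : PolyTime f) {B : α → ℕ} (hB : PolyBdd B)
    (hsB : ∀ x, ∀ i ≤ (l x).length, encSize (f^[i] (s x)) ≤ B x) :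
    PolyTime fun x => f^[(l x).length] (s x) := by
  obtain ⟨p, t, ⟨P, hP⟩, -, hp⟩ := hf
  have hl' := hl.polyBdd
  obtain ⟨q, u, hu, -, hq⟩ := hl.pair hs
  refine ⟨seq q (test (iter p) skip), fun x => u x + (1 + (encSize (l x) *
    (20 + 25 * encSize (l x) + 18 * B x + P.eval (B x)) + 1)), ?_, ?_, fun x r => ?_⟩
  · exact hu.add ((PolyBdd.const 1).add ((hl'.mul ((((PolyBdd.const 20).add
      ((PolyBdd.const 25).mul hl')).add ((PolyBdd.const 18).mul hB)).add (hB.eval P))).add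
      (.const 1)))
  · exact hB.mono fun x => hsB x _ le_rfl
  · have h := exec_iter (p := p) (τ := P.eval (B x)) r (l x) (s x) le_rfl (hsB x) fun i hi r => by
      have h := hp (f^[i] (s x)) r
      rw [← Function.iterate_succ_apply' f i] at h
      exact h.mono ((hP _).trans (polynomial_eval_mono P (hsB x i hi.le)))
    refine (hq x r).seq ?_
    refine Exec.mono (by simpa [enc, Data.code] using Exec.test_true (q := skip) h) ?_
    have := length_le_encSize (l x)
    gcongr

end PolyTime

end

/-! ### Polynomial-time list operations and unary arithmetic -/

namespace PolyTime

variable {α β γ δ : Type} [DataEnc α] [DataEnc β] [DataEnc γ] [DataEnc δ]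

/-- A fold is an iteration on triples of parameter, remaining list and accumulator. A bound `B` on
the accumulators of all prefixes is indispensable: a polynomial-time step may double the size each
time. -/
theorem foldl {l : α → List β} {i : α → γ} {g : α → γ → β → γ} (hl : PolyTime l) (hi : PolyTime i)
    (hg : PolyTime fun p : α × γ × β => g p.1 p.2.1 p.2.2) {B : α → ℕ} (hB : PolyBdd B)
    (h : ∀ x l', l' <+: l x → encSize (l'.foldl (g x) (i x)) ≤ B x) :
    PolyTime fun x => (l x).foldl (g x) (i x) := by
  let F : α × List β × γ → α × List β × γ := fun s =>
    _root_.listCase s.2.1 s fun b t => (s.1, t, g s.1 s.2.2 b)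
  have hF : PolyTime F := by
    refine listCase (by fun_prop) (by fun_prop) ?_
    refine pair (by fun_prop) (pair (by fun_prop) ?_)
    exact hg.comp (f := fun p : α × γ × β => g p.1 p.2.1 p.2.2)
      (g := fun p : (β × List β) × (α × List β × γ) => (p.2.1, p.2.2.2, p.1.1)) (by fun_prop)
  have hit : ∀ x n, n ≤ (l x).length → F^[n] (x, l x, i x) =
      (x, (l x).drop n, ((l x).take n).foldl (g x) (i x)) := by
    intro x n
    induction n with
    | zero => simp
    | succ n ih =>
      intro hn
      have hn' : n < (l x).length := hn
      rw [Function.iterate_succ_apply', ih hn'.le, List.drop_eq_getElem_cons hn',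
        List.take_succ_eq_append_getElem hn', List.foldl_append]
      rfl
  have := (iterate (s := fun x => (x, l x, i x)) hl (by fun_prop) hF
    (B := fun x => 2 + encSize x + encSize (l x) + B x)
    ((((PolyBdd.const 2).add .encSize).add hl.polyBdd).add hB) ?_).snd.snd
  · simpa [hit] using this
  · intro x n hn
    rw [hit x n hn]
    have h₁ := h x _ (List.take_prefix n (l x))
    have h₂ := encSize_le_of_sublist (List.drop_sublist n (l x))
    simp; omega

@[fun_prop]
theorem not {f : α → Bool} (hf : PolyTime f) : PolyTime fun x => !(f x) := by
  have : PolyTime fun x => bif f x then false else true := by fun_prop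
  simpa using this

@[fun_prop]
theorem and {f g : α → Bool} (hf : PolyTime f) (hg : PolyTime g) : PolyTime fun x => f x && g x := by
  have : PolyTime fun x => bif f x then g x else false := by fun_prop
  simpa using this

@[fun_prop]
theorem beq_bool {f g : α → Bool} (hf : PolyTime f) (hg : PolyTime g) :
    PolyTime fun x => f x == g x := by
  have : PolyTime fun x => bif f x then g x else !(g x) := by fun_prop
  refine Eq.mp (congrArg _ (funext fun x => ?_)) this
  cases f x <;> cases g x <;> rfl

@[fun_prop]
theorem isEmpty {l : α → List β} (hl : PolyTime l) : PolyTime fun x => (l x).isEmpty := by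
  have : PolyTime fun x => _root_.listCase (l x) true fun _ _ => false := by fun_prop
  refine Eq.mp (congrArg _ (funext fun x => ?_)) this
  cases l x <;> rfl

@[fun_prop]
theorem tail {l : α → List β} (hl : PolyTime l) : PolyTime fun x => (l x).tail := by
  have : PolyTime fun x => _root_.listCase (l x) [] fun _ t => t := by fun_prop
  refine Eq.mp (congrArg _ (funext fun x => ?_)) this
  cases l x <;> rfl

theorem foldl_cons_eq {ε : Type} (l l' : List ε) : l.foldl (fun a b => b :: a) l' = l.reverse ++ l' := by
  induction l generalizing l' with
  | nil => rfl
  | cons x l ih => simp [ih]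

theorem encSize_reverse (l : List β) : encSize l.reverse = encSize l := by
  induction l with
  | nil => rfl
  | cons x l ih =>
    have := encSize_append l.reverse [x]
    simp at this ⊢; omega

@[fun_prop]
theorem reverseAux {l l' : α → List β} (hl : PolyTime l) (hl' : PolyTime l') :
    PolyTime fun x => (l x).reverse ++ l' x := by
  have := hl.foldl hl' (g := fun _ a b => b :: a) (by fun_prop) (hl.polyBdd.add hl'.polyBdd)
    fun x l₁ h₁ => by
      have h₂ := encSize_le_of_sublist h₁.sublist
      have h₃ := encSize_append l₁.reverse (l' x)
      rw [encSize_reverse] at h₃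
      rw [foldl_cons_eq]; omega
  simpa [foldl_cons_eq] using this

@[fun_prop]
theorem reverse {l : α → List β} (hl : PolyTime l) : PolyTime fun x => (l x).reverse := by
  simpa using hl.reverseAux (const [])

@[fun_prop]
theorem append {l l' : α → List β} (hl : PolyTime l) (hl' : PolyTime l') :
    PolyTime fun x => l x ++ l' x := by
  simpa using hl.reverse.reverseAux hl'

@[fun_prop]
theorem flatMap {l : α → List β} {g : α → β → List γ} (hl : PolyTime l)
    (hg : PolyTime fun p : α × β => g p.1 p.2) : PolyTime fun x => (l x).flatMap (g x) := by
  have e : ∀ x (l : List β) (l' : List γ),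
      l.foldl (fun a b => a ++ g x b) l' = l' ++ l.flatMap (g x) := by
    intro x l
    induction l with
    | nil => simp
    | cons y l ih => intro l'; simp [ih]
  obtain ⟨P, hP⟩ := hg.polyBdd
  have hs : ∀ x (l' : List β), encSize (l'.flatMap (g x)) ≤
      1 + l'.length * P.eval (1 + encSize x + encSize l') := by
    intro x l'
    induction l' with
    | nil => simp
    | cons y l' ih =>
      have h₁ := encSize_append (g x y) (l'.flatMap (g x))
      have h₂ := (hP (x, y)).trans (polynomial_eval_mono P
        (n := 1 + encSize x + encSize (y :: l')) (by simp; omega))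
      have h₃ := Nat.mul_le_mul_left l'.length (polynomial_eval_mono P
        (m := 1 + encSize x + encSize l') (n := 1 + encSize x + encSize (y :: l')) (by simp))
      simp only [List.flatMap_cons, List.length_cons, add_mul, one_mul]
      dsimp only at h₂
      omega
  have := hl.foldl (const []) (g := fun x a b => a ++ g x b) (append (by fun_prop)
    (hg.comp (f := fun p : α × β => g p.1 p.2) (g := fun p : α × List γ × β => (p.1, p.2.2))
      (by fun_prop)))
    (B := fun x => 1 + encSize (l x) * P.eval (1 + encSize x + encSize (l x)))
    ((PolyBdd.const 1).add (hl.polyBdd.mul ((((PolyBdd.const 1).add .encSize).add hl.polyBdd).eval P)))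
    fun x l' h => by
      rw [e, List.nil_append]
      refine (hs x l').trans (Nat.add_le_add_left (Nat.mul_le_mul ?_ (polynomial_eval_mono P ?_)) _)
      · exact h.length_le.trans (length_le_encSize _)
      · have := encSize_le_of_sublist h.sublist
        omega
  simpa [e] using this

@[fun_prop]
theorem map {l : α → List β} {g : α → β → γ} (hl : PolyTime l)
    (hg : PolyTime fun p : α × β => g p.1 p.2) : PolyTime fun x => (l x).map (g x) := by
  have : PolyTime fun x => (l x).flatMap fun y => [g x y] :=
    hl.flatMap (g := fun x y => [g x y]) (hg.cons (const []))
  simpa [← List.map_eq_flatMap] using this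

@[fun_prop]
theorem filter {l : α → List β} {g : α → β → Bool} (hl : PolyTime l)
    (hg : PolyTime fun p : α × β => g p.1 p.2) : PolyTime fun x => (l x).filter (g x) := by
  have : PolyTime fun x => (l x).flatMap fun y => bif g x y then [y] else [] :=
    hl.flatMap (g := fun x y => bif g x y then [y] else []) (hg.cond (by fun_prop) (by fun_prop))
  refine Eq.mp (congrArg _ (funext fun x => ?_)) this
  induction l x with
  | nil => rfl
  | cons y l ih =>
    rw [List.flatMap_cons, ih, List.filter_cons]
    cases g x y <;> rfl

@[fun_prop]
theorem all {l : α → List β} {g : α → β → Bool} (hl : PolyTime l)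
    (hg : PolyTime fun p : α × β => g p.1 p.2) : PolyTime fun x => (l x).all (g x) := by
  have : PolyTime fun x => ((l x).filter fun y => !(g x y)).isEmpty :=
    (hl.filter (g := fun x y => !(g x y)) hg.not).isEmpty
  refine Eq.mp (congrArg _ (funext fun x => ?_)) this
  induction l x with
  | nil => rfl
  | cons y l ih =>
    rw [List.filter_cons, List.all_cons, ← ih]
    cases g x y <;> simp

@[fun_prop]
theorem product {l : α → List β} {l' : α → List γ} (hl : PolyTime l) (hl' : PolyTime l') :
    PolyTime fun x => l x ×ˢ l' x :=
  hl.flatMap (g := fun x a => (l' x).map (Prod.mk a))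
    (map (l := fun p : α × β => l' p.1) (g := fun p b => (p.2, b)) (by fun_prop) (by fun_prop))

/-- Lets a number serve as the list that controls an iteration. -/
theorem replicate_unit : PolyTime fun n : ℕ => List.replicate n () := by
  refine of_enc_eq fun n => ?_
  induction n with
  | zero => rfl
  | succ n ih => exact congrArg (Data.cons .nil) ih

theorem succ : PolyTime fun n : ℕ => n + 1 :=
  (of_enc_eq (f := fun p : Unit × ℕ => p.2 + 1) fun _ => rfl).comp ((const ()).pair .id)

@[fun_prop]
theorem length {l : α → List β} (hl : PolyTime l) : PolyTime fun x => (l x).length := by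
  have e : ∀ (l : List β) n, l.foldl (fun n _ => n + 1) n = n + l.length := by
    intro l
    induction l with
    | nil => simp
    | cons y l ih => intro n; simp [ih]; omega
  have := hl.foldl (const 0) (g := fun _ n _ => n + 1)
    (succ.comp (g := fun p : α × ℕ × β => p.2.1) (by fun_prop))
    (((PolyBdd.const 2).mul hl.polyBdd).add (.const 1)) fun x l' h => by
      have h₁ := h.length_le
      have h₂ := length_le_encSize (l x)
      rw [e]; simp; omega
  simpa [e] using this

@[fun_prop]
theorem add_one {f : α → ℕ} (hf : PolyTime f) : PolyTime fun x => f x + 1 := succ.comp hf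

theorem drop {l : α → List β} {n : α → ℕ} (hl : PolyTime l) (hn : PolyTime n) :
    PolyTime fun x => (l x).drop (n x) := by
  have e : ∀ n (l : List β), List.tail^[n] l = l.drop n := by
    intro n
    induction n with
    | zero => simp
    | succ n ih => intro l; simp [ih]
  have := (replicate_unit.comp hn).iterate hl (tail .id) hl.polyBdd fun x i _ => by
    rw [e]; exact encSize_le_of_sublist (List.drop_sublist _ _)
  simpa [e] using this

-- Dropping `n` entries from a list of `m` units leaves nothing exactly if `m ≤ n`.
@[fun_prop]
theorem decide_le {m n : α → ℕ} (hm : PolyTime m) (hn : PolyTime n) :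
    PolyTime fun x => decide (m x ≤ n x) := by
  refine Eq.mp (congrArg _ (funext fun x => ?_)) ((replicate_unit.comp hm).drop hn).isEmpty
  rw [Bool.eq_iff_iff]
  simp [Nat.sub_eq_zero_iff_le]

@[fun_prop]
theorem decide_lt {m n : α → ℕ} (hm : PolyTime m) (hn : PolyTime n) :
    PolyTime fun x => decide (m x < n x) := by
  have : PolyTime fun x => decide (m x + 1 ≤ n x) := by fun_prop
  exact this

theorem range : PolyTime List.range := by
  have e : ∀ n, (List.replicate n ()).foldl (fun (a : List ℕ) _ => a ++ [a.length]) [] =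
      List.range n := by
    intro n
    induction n with
    | zero => rfl
    | succ n ih => rw [List.replicate_succ', List.foldl_append, ih, List.range_succ]; simp
  have := replicate_unit.foldl (const []) (g := fun _ (a : List ℕ) _ => a ++ [a.length])
    (by fun_prop) (B := fun n => 1 + encSize n * (1 + encSize n))
    ((PolyBdd.const 1).add (PolyBdd.encSize.mul ((PolyBdd.const 1).add .encSize)))
    fun n l' h => by
      have h₁ := h.length_le
      have : l' = List.replicate l'.length () := List.eq_replicate_of_mem fun _ _ => rfl
      rw [List.length_replicate] at h₁
      rw [this, e]
      refine (encSize_le_of_forall (m := encSize n) fun x hx => ?_).trans ?_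
      · have := List.mem_range.1 hx
        simp; omega
      · simp only [List.length_range]
        have : l'.length ≤ encSize n := by simp; omega
        gcongr
  simpa [e] using this

end PolyTime

/-! ### The dynamic program -/

/-- A pair of points `((x, y), (u, v))`: the entry `y` at position `x` of a first word is matched with
the entry `v` at position `u` of a second word. -/
abbrev Match : Type := (ℕ × ℕ) × (ℕ × ℕ)

namespace Match

/-- The second match lies to the right of the first one in both words, and its entries compare in the
same way with those of the first one in both words. -/
def compat (a b : Match) : Bool :=
  (decide (a.1.1 < b.1.1) && decide (a.2.1 < b.2.1)) &&
    (decide (a.1.2 < b.1.2) == decide (a.2.2 < b.2.2))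

/-- The coordinatewise order. -/
def below (a b : Match) : Bool :=
  (decide (a.1.1 ≤ b.1.1) && decide (a.1.2 ≤ b.1.2)) &&
    (decide (a.2.1 ≤ b.2.1) && decide (a.2.2 ≤ b.2.2))

/-- The match lies in the box with the given lowest and highest corner. -/
def inBox (b : Match × Match) (a : Match) : Bool := below b.1 a && below a b.2

end Match

/-- The points of the graph of a word, from the unary encoding of the word. -/
def points (l : List Bool) : List (ℕ × ℕ) :=
  -- The state consists of the number of ones since the last zero and the points found so far; the
  -- number of these points is the position of the next entry.
  (l.foldl (fun (s : ℕ × List (ℕ × ℕ)) b =>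
    bif b then (s.1 + 1, s.2) else (0, s.2 ++ [(s.2.length, s.1)])) (0, [])).2

/-- All matches of two words, given by their encodings with their symbols tagged by `false` and
`true`, respectively. -/
def allMatches (l : List (Bool × Bool)) : List Match :=
  points ((l.filter fun p => !p.1).map Prod.snd) ×ˢ points ((l.filter fun p => p.1).map Prod.snd)

/-- The boxes the coordinates of whose corners are coordinates of given matches. -/
def boxes (G : List Match) : List (Match × Match) :=
  let c : List ℕ := G.flatMap fun a => [a.1.1, a.1.2, a.2.1, a.2.2]
  let q : List Match := (c ×ˢ c) ×ˢ (c ×ˢ c)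
  q ×ˢ q

/-- The first one of the longest lists of a list of lists, if there is one. -/
def longest {α : Type} (L : List (List α)) : List α :=
  L.foldl (fun m s => if m.length < s.length then s else m) []

/-- The lists with a single match, and the concatenations of lists in `T` that are compatible. -/
def candidates (G : List Match) (T : List (List Match)) : List (List Match) :=
  G.map (fun a => [a]) ++
    ((T ×ˢ T).filter fun p => p.1.all fun a => p.2.all fun b => a.compat b).map fun p => p.1 ++ p.2

/-- The longest candidates in the boxes. -/
def improve (G : List Match) (T : List (List Match)) : List (List Match) :=
  (boxes G).map fun b => longest ((candidates G T).filter fun s => s.all (Match.inBox b))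

/-- For all boxes a list of compatible matches, after as many rounds as there are matches. -/
def table (G : List Match) : List (List Match) := G.foldl (fun T _ => improve G T) []

/-- The ranks of the entries in the first word of a list of matches. -/
def ranks (s : List Match) : List ℕ :=
  s.map fun a => (s.filter fun b => decide (b.1.2 ≤ a.1.2)).length

/-- The encoding of a longest common separable pattern of two words. -/
def solution (l : List (Bool × Bool)) : List Bool :=
  (ranks (longest (table (allMatches l)))).flatMap fun v => List.replicate v true ++ [false]

theorem longest_aux {α : Type} (L : List (List α)) (m : List α) :
    let t := L.foldl (fun m s => if m.length < s.length then s else m) m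
    (t = m ∨ t ∈ L) ∧ m.length ≤ t.length ∧ ∀ s ∈ L, s.length ≤ t.length := by
  induction L generalizing m with
  | nil => simp
  | cons s L ih =>
    obtain ⟨h₁, h₂, h₃⟩ := ih (if m.length < s.length then s else m)
    simp only [List.foldl_cons, List.mem_cons, forall_eq_or_imp]
    refine ⟨?_, ?_, ?_, h₃⟩
    · rcases h₁ with h₁ | h₁
      · rw [h₁]
        split_ifs <;> simp
      · exact Or.inr (Or.inr h₁)
    · refine le_trans ?_ h₂
      split_ifs <;> omega
    · refine le_trans ?_ h₂
      split_ifs <;> omega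

theorem longest_mem {α : Type} (L : List (List α)) : longest L = [] ∨ longest L ∈ L :=
  (longest_aux L []).1

theorem length_le_longest {α : Type} {L : List (List α)} {s : List α} (h : s ∈ L) :
    s.length ≤ (longest L).length :=
  (longest_aux L []).2.2 s h

/-- A list of pairwise compatible matches, all of them in `G`. -/
def Consistent (G s : List Match) : Prop := s.Pairwise (fun a b => a.compat b) ∧ ∀ a ∈ s, a ∈ G

theorem Consistent.nil (G : List Match) : Consistent G [] := ⟨.nil, by simp⟩

theorem Consistent.nodup {G s : List Match} (h : Consistent G s) : s.Nodup :=
  h.1.imp fun {a b} hab e => by subst e; simp [Match.compat] at hab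

/-- Bounds both the stored lists, hence the size of the table, and the number of rounds that are
needed. -/
theorem Consistent.length_le {G s : List Match} (h : Consistent G s) : s.length ≤ G.length :=
  (h.nodup.subperm h.2).length_le

theorem Consistent.of_mem_candidates {G : List Match} {T : List (List Match)}
    (hT : ∀ s ∈ T, Consistent G s) {s : List Match} (hs : s ∈ candidates G T) :
    Consistent G s := by
  simp only [candidates, List.mem_append, List.mem_map, List.mem_filter,
    List.all_eq_true] at hs
  rcases hs with ⟨a, ha, rfl⟩ | ⟨⟨s₁, s₂⟩, ⟨h₀, h⟩, rfl⟩
  · exact ⟨List.pairwise_singleton _ _, by simpa using ha⟩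
  · obtain ⟨h₁, h₂⟩ := List.pair_mem_product.1 h₀
    exact ⟨List.pairwise_append.2 ⟨(hT _ h₁).1, (hT _ h₂).1, h⟩, fun a ha =>
      (List.mem_append.1 ha).elim ((hT _ h₁).2 a) ((hT _ h₂).2 a)⟩

theorem Consistent.of_mem_improve {G : List Match} {T : List (List Match)}
    (hT : ∀ s ∈ T, Consistent G s) {s : List Match} (hs : s ∈ improve G T) :
    Consistent G s := by
  obtain ⟨b, -, rfl⟩ := List.mem_map.1 hs
  rcases longest_mem ((candidates G T).filter fun s => s.all (Match.inBox b)) with h | h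
  · rw [h]; exact .nil G
  · exact .of_mem_candidates hT (List.mem_filter.1 h).1

theorem Consistent.of_mem_foldl {G l : List Match} {s : List Match}
    (hs : s ∈ l.foldl (fun T _ => improve G T) []) : Consistent G s := by
  induction l using List.reverseRecOn generalizing s with
  | nil => simp at hs
  | append_singleton l a ih =>
    rw [List.foldl_append] at hs
    exact .of_mem_improve (fun s hs => ih hs) hs

/-! ### The dynamic program runs in polynomial time -/

namespace PolyTime

variable {α : Type} [DataEnc α]

@[fun_prop]
theorem compat {f g : α → Match} (hf : PolyTime f) (hg : PolyTime g) :
    PolyTime fun x => (f x).compat (g x) := by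
  unfold Match.compat
  fun_prop

@[fun_prop]
theorem below {f g : α → Match} (hf : PolyTime f) (hg : PolyTime g) :
    PolyTime fun x => (f x).below (g x) := by
  unfold Match.below
  fun_prop

@[fun_prop]
theorem inBox {f : α → Match × Match} {g : α → Match} (hf : PolyTime f) (hg : PolyTime g) :
    PolyTime fun x => Match.inBox (f x) (g x) := by
  unfold Match.inBox
  fun_prop

theorem points : PolyTime points := by
  -- The counter, the number of points and their coordinates never exceed the number of symbols
  -- read, so all unary numbers stay small.
  have e : ∀ l : List Bool, let s := l.foldl (fun (s : ℕ × List (ℕ × ℕ)) b =>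
      bif b then (s.1 + 1, s.2) else (0, s.2 ++ [(s.2.length, s.1)])) (0, [])
      s.1 ≤ l.length ∧ s.2.length ≤ l.length ∧ ∀ p ∈ s.2, p.1 ≤ l.length ∧ p.2 ≤ l.length := by
    intro l
    induction l using List.reverseRecOn with
    | nil => simp
    | append_singleton l b ih =>
      rw [List.foldl_append]
      obtain ⟨h₁, h₂, h₃⟩ := ih
      generalize l.foldl (fun (s : ℕ × List (ℕ × ℕ)) b =>
        bif b then (s.1 + 1, s.2) else (0, s.2 ++ [(s.2.length, s.1)])) (0, []) = s at *
      cases b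
      · simp only [List.foldl_cons, List.foldl_nil, cond_false, List.length_append,
          List.length_singleton, List.mem_append, List.mem_singleton]
        refine ⟨by omega, by omega, fun p hp => ?_⟩
        rcases hp with hp | rfl
        · have := h₃ p hp; omega
        · exact ⟨by simp; omega, by simp; omega⟩
      · simp only [List.foldl_cons, List.foldl_nil, cond_true, List.length_append,
          List.length_singleton]
        refine ⟨by omega, by omega, fun p hp => ?_⟩
        have := h₃ p hp; omega
  refine (PolyTime.id.foldl (const (0, [])) (g := fun _ (s : ℕ × List (ℕ × ℕ)) b =>
      bif b then (s.1 + 1, s.2) else (0, s.2 ++ [(s.2.length, s.1)])) (by fun_prop)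
    (B := fun l => 1 + (2 * encSize l + 1) +
      (1 + encSize l * (1 + (1 + (2 * encSize l + 1) + (2 * encSize l + 1)))))
    ?_ fun l l' h => ?_).snd
  · have := (((PolyBdd.const 2).mul (PolyBdd.encSize (α := List Bool))).add (.const 1))
    exact ((PolyBdd.const 1).add this).add ((PolyBdd.const 1).add (PolyBdd.encSize.mul
      ((PolyBdd.const 1).add (((PolyBdd.const 1).add this).add this))))
  · obtain ⟨h₁, h₂, h₃⟩ := e l'
    have h₀ := h.length_le.trans (length_le_encSize l)
    generalize l'.foldl (fun (s : ℕ × List (ℕ × ℕ)) b =>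
        bif b then (s.1 + 1, s.2) else (0, s.2 ++ [(s.2.length, s.1)])) (0, []) = s at *
    obtain ⟨n, s⟩ := s
    have h₄ := encSize_le_of_forall (m := 1 + (2 * encSize l + 1) + (2 * encSize l + 1))
      (l := s) fun p hp => by
        obtain ⟨i, j⟩ := p
        have := h₃ _ hp
        simp at this ⊢; omega
    have h₅ := Nat.mul_le_mul_right (1 + (1 + (2 * encSize l + 1) + (2 * encSize l + 1)))
      (h₂.trans h₀)
    simp only [encSize_pair, encSize_nat] at h₁ h₂ h₅ ⊢
    omega

theorem allMatches : PolyTime allMatches := by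
  have h₁ : PolyTime fun l : List (Bool × Bool) =>
      _root_.points ((l.filter fun p => !p.1).map fun p => p.2) := points.comp (by fun_prop)
  have h₂ : PolyTime fun l : List (Bool × Bool) =>
      _root_.points ((l.filter fun p => p.1).map fun p => p.2) := points.comp (by fun_prop)
  exact h₁.product h₂

theorem boxes : PolyTime boxes := by
  unfold _root_.boxes
  fun_prop

theorem longest {β : Type} [DataEnc β] : PolyTime (longest : List (List β) → List β) := by
  refine PolyTime.id.foldl (const []) (g := fun _ (m s : List β) => if m.length < s.length then s else m)
    ?_ (PolyBdd.encSize) fun L L' h => ?_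
  · exact ite (c := fun p : List (List β) × List β × List β => p.2.1.length < p.2.2.length)
      (by fun_prop) (by fun_prop) (by fun_prop)
  · rcases longest_mem L' with h' | h'
    · exact (congrArg encSize h').trans_le (one_le_encSize L)
    · exact encSize_le_of_mem (h.subset h')

theorem improve : PolyTime fun p : List Match × List (List Match) => improve p.1 p.2 := by
  have h : PolyTime fun p : List Match × List (List Match) => candidates p.1 p.2 := by
    unfold candidates
    fun_prop
  refine map (l := fun p : List Match × List (List Match) => _root_.boxes p.1)
    (g := fun p b => _root_.longest ((candidates p.1 p.2).filter fun s => s.all (Match.inBox b)))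
    (boxes.comp (by fun_prop)) (longest.comp (filter
      (l := fun p : (List Match × List (List Match)) × (Match × Match) => candidates p.1.1 p.1.2)
      (h.comp (by fun_prop)) (by fun_prop)))

/-- Concatenation could double the lists in every round, but all of them are consistent: at most |G|
entries, each taken from `G`. A nonempty table has one row per box. -/
theorem table : PolyTime table := by
  have h : PolyBdd fun G : List Match => encSize (_root_.boxes G) := boxes.polyBdd
  refine PolyTime.id.foldl (const []) (g := fun G T _ => _root_.improve G T)
    (improve.comp (g := fun p : List Match × List (List Match) × Match => (p.1, p.2.1))
      (by fun_prop))
    (B := fun G => 1 + encSize (_root_.boxes G) * (1 + (1 + encSize G * (1 + encSize G))))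
    ((PolyBdd.const 1).add (h.mul ((PolyBdd.const 1).add ((PolyBdd.const 1).add
      (PolyBdd.encSize.mul ((PolyBdd.const 1).add .encSize)))))) fun G l' _ => ?_
  have h₁ : (l'.foldl (fun T _ => _root_.improve G T) []).length ≤ encSize (_root_.boxes G) := by
    induction l' using List.reverseRecOn with
    | nil => simp
    | append_singleton l a _ =>
      rw [List.foldl_append]
      simpa [_root_.improve] using length_le_encSize _
  refine (encSize_le_of_forall (m := 1 + encSize G * (1 + encSize G)) fun s hs => ?_).trans
    (Nat.add_le_add_left (Nat.mul_le_mul_right _ h₁) _)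
  have hs' := Consistent.of_mem_foldl hs
  refine (encSize_le_of_forall (m := encSize G) fun a ha => encSize_le_of_mem (hs'.2 a ha)).trans ?_
  have := hs'.length_le.trans (length_le_encSize G)
  gcongr

theorem solution : PolyTime solution := by
  have h₁ : PolyTime fun n : ℕ => List.replicate n true := by
    have : PolyTime fun n : ℕ => (List.replicate n ()).map fun _ => true :=
      replicate_unit.map (g := fun _ _ => true) (by fun_prop)
    simpa using this
  have h₂ : PolyTime ranks := by
    unfold ranks
    fun_prop
  exact flatMap (g := fun _ v => List.replicate v true ++ [false])
    (h₂.comp (longest.comp (table.comp allMatches)))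
    ((h₁.comp (g := fun p : List (Bool × Bool) × ℕ => p.2) (by fun_prop)).append (by fun_prop))

end PolyTime

/-! ### Input, output and the passage to Turing machines -/

namespace StackProg

theorem code_enc_nil {α : Type} [DataEnc α] : (enc ([] : List α)).code = [false] := rfl

theorem code_enc_cons {α : Type} [DataEnc α] (x : α) (l : List α) :
    (enc (x :: l)).code = true :: ((enc x).code ++ (enc l).code) := rfl

/-- A symbol of the input as a symbol tagged by the alphabet it comes from. -/
def tagged : Bool ⊕ Bool → Bool × Bool :=
  Sum.elim (Prod.mk false) (Prod.mk true)

theorem encSize_tagged_le (x : Bool ⊕ Bool) : encSize (tagged x) ≤ 7 := by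
  rcases x with (_ | _) | (_ | _) <;> decide

/-- Move the input to stack `a`, as a list in the reverse order. -/
def load : StackProg Alph :=
  seq (push (.reg .a) false) (loop .inp (fun _ => false) fun x =>
    pushList (true :: (enc (tagged x)).code))

theorem runs_load (s : List (Bool ⊕ Bool)) :
    Runs load (tapes s [] (regs [] [] [] []))
      (tapes [] [] (regs (enc (s.map tagged).reverse).code [] [] [])) (10 * s.length + 2) := by
  have h : ∀ (s : List (Bool ⊕ Bool)) (l : List (Bool × Bool)),
      Runs (loop .inp (fun _ => false) fun x => pushList (true :: (enc (tagged x)).code))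
      (tapes s [] (regs (enc l).code [] [] []))
      (tapes [] [] (regs (enc ((s.map tagged).reverse ++ l)).code [] [] []))
      (10 * s.length + 1) := by
    intro s
    induction s with
    | nil => exact fun l => Runs.loop_nil (k := Stk.inp) rfl
    | cons x s ih =>
      intro l
      have h₁ := runs_pushList s [] (true :: (enc (tagged x)).code) (enc l).code [] [] []
      have h₂ := ih (tagged x :: l)
      have h₃ := Runs.loop_cons (k := Stk.inp) (a := x) (l := s) (exits := fun _ => false)
        (S := tapes (x :: s) [] (regs (enc l).code [] [] []))
        (q := fun x => pushList (true :: (enc (tagged x)).code)) rfl rfl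
        (by simpa [List.append_assoc] using h₁) (by simpa only [code_enc_cons] using h₂)
      have h₄ := encSize_tagged_le x
      rw [encSize] at h₄
      refine Runs.mono (by simpa using h₃) ?_
      simp; omega
  have h₁ := Runs.push (tapes s [] (regs [] [] [] [])) (.reg .a) false
  simp at h₁
  have h₂ := h₁.seq (h s [])
  exact Runs.mono (by simpa [load] using h₂) (by omega)

/-- Move a list of bits from stack `a` to the output stack, in the reverse order. -/
def unload : StackProg Alph :=
  loop (.reg .a) (fun x => !x) fun _ =>
    -- The two inner tests remove the leaves of the tree `cons nil nil` of a bit `true`.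
    test (seq (test skip skip) (seq (test skip skip) (push .out true))) (push .out false)

theorem runs_unload (l o : List Bool) :
    Runs unload (tapes [] o (regs (enc l).code [] [] []))
      (tapes [] (l.reverse ++ o) (regs [] [] [] [])) (10 * l.length + 1) := by
  have ht : ∀ (p q : StackProg Alph) (x : Bool) (a o : List Bool) S t,
      Runs (if x then p else q) (tapes [] o (regs a [] [] [])) S t →
      Runs (test p q) (tapes [] o (regs (x :: a) [] [] [])) S (1 + t) := fun p q x a o S t h =>
    Runs.pop_cons (k := Stk.reg .a) (a := x) (l := a) rfl (by simpa using h)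
  have hs : ∀ a o, Runs skip (tapes [] o (regs a [] [] [])) (tapes [] o (regs a [] [] [])) 1 :=
    fun _ _ => Runs.skip _
  have hp : ∀ x a, Runs (push .out x) (tapes [] o (regs a [] [] []))
      (tapes [] (x :: o) (regs a [] [] [])) 1 := fun x a => by
    simpa [tapes] using Runs.push (tapes [] o (regs a [] [] [])) .out x
  induction l generalizing o with
  | nil =>
    simpa [unload, code_enc_nil] using Runs.loop_stop (S := tapes [] o (regs [false] [] [] []))
      (k := .reg .a) (exits := fun x => !x) (a := false) rfl rfl
  | cons x l ih =>
    have ih' := ih (x :: o) (fun y a => by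
      simpa [tapes] using Runs.push (tapes [] (x :: o) (regs a [] [] [])) .out y)
    have h : Runs (test (seq (test skip skip) (seq (test skip skip) (push .out true)))
        (push .out false)) (tapes [] o (regs ((enc x).code ++ (enc l).code) [] [] []))
        (tapes [] (x :: o) (regs (enc l).code [] [] [])) 6 := by
      cases x with
      | false => exact (ht _ _ false _ _ _ _ (hp false _)).mono (by omega)
      | true =>
        exact ht _ _ true _ _ _ _ ((ht skip skip false _ _ _ _ (hs _ _)).seq
          ((ht skip skip false _ _ _ _ (hs _ _)).seq (hp true _)))
    have h' := Runs.loop_cons (k := Stk.reg .a) (a := true) (l := (enc x).code ++ (enc l).code)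
      (S := tapes [] o (regs (true :: ((enc x).code ++ (enc l).code)) [] [] []))
      (exits := fun x => !x)
      (q := fun _ => test (seq (test skip skip) (seq (test skip skip) (push .out true)))
        (push .out false)) rfl rfl (by simpa using h) ih'
    refine Runs.mono (by simpa [unload, code_enc_cons] using h') ?_
    simp; omega

end StackProg

theorem PolyTime.exists_runs {f : List (Bool × Bool) → List Bool} (hf : PolyTime f) :
    ∃ (p : StackProg Alph) (P : Polynomial ℕ), ∀ s : List (Bool ⊕ Bool),
      Runs p (Function.update (fun _ => []) .inp s)
        (Function.update (fun _ => []) .out (f (s.map tagged))) (P.eval s.length) := by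
  -- `load` and `unload` both reverse, so the program is taken for `f` with its argument and its
  -- value reversed.
  obtain ⟨p, t, ⟨P, hP⟩, ⟨Q, hQ⟩, hp⟩ :=
    (hf.comp (reverse (l := fun l => l) PolyTime.id)).reverse
  have he : (fun _ => []) = tapes [] [] (regs [] [] [] []) := by
    funext k
    rcases k with _ | _ | _ | _ | _ | _ <;> rfl
  -- A list of tagged symbols has one leaf at its end, and each entry contributes a cons node and a
  -- tree of size at most 7.
  let X : Polynomial ℕ := 8 * Polynomial.X + 1
  have hX : ∀ s : List (Bool ⊕ Bool), encSize (s.map tagged).reverse ≤ X.eval s.length := by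
    intro s
    refine (encSize_le_of_forall (m := 7) fun x hx => ?_).trans ?_
    · obtain ⟨y, -, rfl⟩ := List.mem_map.1 (List.mem_reverse.1 hx)
      exact encSize_tagged_le y
    · simp [X]; omega
  refine ⟨seq load (seq p unload), (10 * Polynomial.X + 2) + (P.comp X + (10 * Q.comp X + 1)),
    fun s => ?_⟩
  have h₁ := runs_load s
  have h₂ := hp (s.map tagged).reverse []
  have h₃ := runs_unload (f (s.map tagged)).reverse []
  simp only [List.append_nil, List.reverse_reverse, Exec] at h₂ h₃
  rw [he, update_tapes_inp, update_tapes_out]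
  refine (h₁.seq (h₂.seq h₃)).mono ?_
  have h₄ := (hP (s.map tagged).reverse).trans (polynomial_eval_mono P (hX s))
  have h₅ := ((length_le_encSize _).trans (hQ (s.map tagged).reverse)).trans
    (polynomial_eval_mono Q (hX s))
  simp only [List.reverse_reverse] at h₅
  simp only [Polynomial.eval_add, Polynomial.eval_mul, Polynomial.eval_comp, Polynomial.eval_X,
    Polynomial.eval_one, Polynomial.eval_ofNat]
  omega

/-- A function on words over two copies of `{0, 1}` that is computed by a stack program in polynomial
time is computed by a Turing machine in polynomial time. -/
theorem PolyTime.computable {f : List (Bool × Bool) → List Bool} (hf : PolyTime f) {α β : Type}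
    {ea : α → List (Bool ⊕ Bool)} {eb : β → List Bool} {g : α → β}
    (hg : ∀ a, eb (g a) = f ((ea a).map tagged)) :
    Nonempty (TM2ComputableInPolyTime ea eb g) := by
  obtain ⟨p, P, hp⟩ := hf.exists_runs
  refine ⟨⟨⟨machine p .inp .out, Equiv.refl _, Equiv.refl _⟩, P + 1, fun a => ?_⟩⟩
  have h := (machine_outputs (hp (ea a))).some
  have e₁ : List.map (Equiv.refl (Bool ⊕ Bool)).invFun (ea a) = ea a := by simp
  have e₂ : List.map (Equiv.refl Bool).invFun (eb (g a)) = f ((ea a).map tagged) := by simp [hg]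
  rw [Polynomial.eval_add, Polynomial.eval_one]
  let F (x : List (Bool ⊕ Bool)) (y : List Bool) : Type :=
    TM2OutputsInTime (machine p .inp .out) x (some y) (P.eval (ea a).length + 1)
  exact cast (congrArg₂ F e₁.symm e₂.symm) h

/-! ### Splitting of separable words -/

section Splitting

/-- A word avoids `3 1 4 2` and `2 4 1 3`. -/
def SepWord (w : List ℕ) : Prop :=
  ∀ a b c d, List.Sublist [a, b, c, d] w → ¬(b < d ∧ d < a ∧ a < c) ∧ ¬(c < a ∧ a < d ∧ d < b)

theorem SepWord.of_sublist {w w' : List ℕ} (h : SepWord w) (h' : List.Sublist w' w) : SepWord w' :=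
  fun a b c d hs => h a b c d (hs.trans h')

/-- A word is the concatenation of two nonempty words, all entries of one of which are smaller than
all entries of the other one. -/
def Splits (w : List ℕ) : Prop :=
  ∃ u v, u ≠ [] ∧ v ≠ [] ∧ w = u ++ v ∧
    ((∀ a ∈ u, ∀ b ∈ v, a < b) ∨ (∀ a ∈ u, ∀ b ∈ v, b < a))

/-- For a strict total order `r`, let all entries of `u` precede all entries of `v`, and let no entry
of `v` that precedes `a` stand after one that `a` precedes. Then `a :: (u ++ v)` can be cut inside `v`,
or `a` comes after all entries of `u ++ v`. -/
theorem exists_split_cons (r : ℕ → ℕ → Prop) [DecidableRel r] (ht : ∀ {a b c}, r a b → r b c → r a c)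
    (hr : ∀ {a b}, ¬ r a b → a ≠ b → r b a) {a : ℕ} {u v : List ℕ} (hv : v ≠ [])
    (huv : ∀ x ∈ u, ∀ y ∈ v, r x y) (hav : a ∉ v)
    (h : ∀ x y, List.Sublist [x, y] v → ¬(r y a ∧ r a x)) :
    (∃ v₁ v₂, v₂ ≠ [] ∧ v = v₁ ++ v₂ ∧ ∀ x ∈ a :: (u ++ v₁), ∀ y ∈ v₂, r x y) ∨
      ∀ x ∈ u ++ v, r x a := by
  have hp : ∀ x ∈ v.takeWhile fun x => r x a, r x a := fun x hx => by
    simpa using List.mem_takeWhile_imp hx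
  -- The cut is made before the first entry of `v` that does not precede `a`; by `h`, no later entry
  -- precedes `a` either. Without such an entry all of `v` precedes `a`, and so does `u`, because
  -- `v` is nonempty.
  have e := List.takeWhile_append_dropWhile (p := fun x => decide (r x a)) (l := v)
  rcases hq : v.dropWhile fun x => r x a with _ | ⟨x, q⟩
  · right
    rw [hq, List.append_nil] at e
    rw [e] at hp
    intro x hx
    rcases List.mem_append.1 hx with hx | hx
    · obtain ⟨y, hy⟩ := List.exists_mem_of_ne_nil v hv
      exact ht (huv x hx y hy) (hp y hy)
    · exact hp x hx
  · left
    rw [hq] at e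
    have hne : ∀ y ∈ x :: q, a ≠ y := fun y hy he => hav (he ▸ e ▸ List.mem_append_right _ hy)
    have hx : r a x := by
      refine hr (fun hxa => ?_) (hne x (by simp)).symm
      have := List.dropWhile_get_zero_not (p := fun x => decide (r x a)) v (by rw [hq]; simp)
      simp [hq, hxa] at this
    have hq' : ∀ y ∈ x :: q, r a y := by
      intro y hy
      rcases List.mem_cons.1 hy with rfl | hy'
      · exact hx
      · refine hr (fun hya => h x y ?_ ⟨hya, hx⟩) (hne y hy).symm
        rw [← e]
        exact (List.Sublist.cons_cons x (List.singleton_sublist.2 hy')).trans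
          (List.sublist_append_right _ _)
    refine ⟨_, _, List.cons_ne_nil x q, e.symm, fun z hz y hy => ?_⟩
    rcases List.mem_cons.1 hz with rfl | hz
    · exact hq' y hy
    · rcases List.mem_append.1 hz with hz | hz
      · exact huv z hz y (e ▸ List.mem_append_right _ hy)
      · exact ht (hp z hz) (hq' y hy)

/-- Induction on the word, with a letter `a` added in front of a splitting `u`, `v`. Let `z` be in
`u` and `x` before `y` in `v`. If `u` lies below `v`, then y < a < x would make a z x y a 3142; if
`u` lies above, then x < a < y would make it a 2413. So either `v` can be cut around `a`, or `a` is
beyond all other letters and can be split off alone. -/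
theorem SepWord.splits {w : List ℕ} (h : SepWord w) (hw : w.Nodup) (h₂ : 2 ≤ w.length) :
    Splits w := by
  induction w with
  | nil => simp at h₂
  | cons a w ih =>
    have haw := (List.nodup_cons.1 hw).1
    by_cases h₃ : 2 ≤ w.length
    · obtain ⟨u, v, hu, hv, rfl, huv⟩ := ih (h.of_sublist (List.sublist_cons_self _ _))
        (List.nodup_cons.1 hw).2 h₃
      have hav : a ∉ v := fun h => haw (List.mem_append_right _ h)
      obtain ⟨z, hz⟩ := List.exists_mem_of_ne_nil u hu
      have hs : ∀ x y, List.Sublist [x, y] v → List.Sublist [a, z, x, y] (a :: (u ++ v)) :=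
        fun x y hxy => List.Sublist.cons_cons a ((List.singleton_sublist.2 hz).append hxy)
      rcases huv with huv | huv
      · rcases exists_split_cons (· < ·) (fun h h' => lt_trans h h')
          (fun h h' => lt_of_le_of_ne (not_lt.1 h) h'.symm) hv huv hav
          (fun x y hxy hr => (h _ _ _ _ (hs x y hxy)).1
            ⟨huv z hz y (hxy.subset (by simp)), hr⟩) with ⟨v₁, v₂, hv₂, rfl, h'⟩ | h'
        · exact ⟨a :: (u ++ v₁), v₂, by simp, hv₂, by simp, Or.inl h'⟩
        · exact ⟨[a], u ++ v, by simp, by simp [hu], by simp, Or.inr (by simpa using h')⟩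
      · rcases exists_split_cons (· > ·) (fun h h' => lt_trans h' h)
          (fun h h' => lt_of_le_of_ne (not_lt.1 h) h') hv huv hav
          (fun x y hxy hr => (h _ _ _ _ (hs x y hxy)).2
            ⟨hr.2, hr.1, huv z hz y (hxy.subset (by simp))⟩) with ⟨v₁, v₂, hv₂, rfl, h'⟩ | h'
        · exact ⟨a :: (u ++ v₁), v₂, by simp, hv₂, by simp, Or.inr h'⟩
        · exact ⟨[a], u ++ v, by simp, by simp [hu], by simp, Or.inl (by simpa using h')⟩
    · obtain ⟨b, rfl⟩ : ∃ b, w = [b] := List.length_eq_one_iff.1 (by simp at h₂; omega)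
      refine ⟨[a], [b], by simp, by simp, rfl, ?_⟩
      have : a ≠ b := by simpa using haw
      simpa using lt_or_gt_of_ne this

end Splitting

/-! ### Correctness of the dynamic program -/

/-- The entries in the first word of a list of matches. -/
def firstWord (s : List Match) : List ℕ := s.map fun a => a.1.2

theorem Match.compat_iff {a b : Match} : a.compat b = true ↔
    a.1.1 < b.1.1 ∧ a.2.1 < b.2.1 ∧ (a.1.2 < b.1.2 ↔ a.2.2 < b.2.2) := by
  simp [Match.compat, and_assoc]

theorem Match.inBox_iff {b : Match × Match} {a : Match} : Match.inBox b a = true ↔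
    (b.1.1.1 ≤ a.1.1 ∧ b.1.1.2 ≤ a.1.2 ∧ b.1.2.1 ≤ a.2.1 ∧ b.1.2.2 ≤ a.2.2) ∧
    (a.1.1 ≤ b.2.1.1 ∧ a.1.2 ≤ b.2.1.2 ∧ a.2.1 ≤ b.2.2.1 ∧ a.2.2 ≤ b.2.2.2) := by
  simp [Match.inBox, Match.below, and_assoc]

/-- The smallest box that contains given matches. -/
def IsBoundingBox (s : List Match) (b : Match × Match) : Prop :=
  (∀ a ∈ s, Match.inBox b a) ∧
    ((∃ a ∈ s, a.1.1 = b.1.1.1) ∧ (∃ a ∈ s, a.1.2 = b.1.1.2) ∧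
      (∃ a ∈ s, a.2.1 = b.1.2.1) ∧ (∃ a ∈ s, a.2.2 = b.1.2.2)) ∧
    ((∃ a ∈ s, a.1.1 = b.2.1.1) ∧ (∃ a ∈ s, a.1.2 = b.2.1.2) ∧
      (∃ a ∈ s, a.2.1 = b.2.2.1) ∧ (∃ a ∈ s, a.2.2 = b.2.2.2))

/-- Every face of `b` is touched by a match in `s`, and this match lies in `b'`. -/
theorem IsBoundingBox.inBox {s : List Match} {b b' : Match × Match} (hb : IsBoundingBox s b)
    (h : ∀ a ∈ s, Match.inBox b' a) {a : Match} (ha : Match.inBox b a) : Match.inBox b' a := by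
  obtain ⟨-, ⟨⟨x₁, y₁, e₁⟩, ⟨x₂, y₂, e₂⟩, ⟨x₃, y₃, e₃⟩, ⟨x₄, y₄, e₄⟩⟩,
    ⟨x₅, y₅, e₅⟩, ⟨x₆, y₆, e₆⟩, ⟨x₇, y₇, e₇⟩, ⟨x₈, y₈, e₈⟩⟩ := hb
  simp only [Match.inBox_iff] at h ha ⊢
  rw [← e₁, ← e₂, ← e₃, ← e₄, ← e₅, ← e₆, ← e₇, ← e₈] at ha
  exact ⟨⟨(h _ y₁).1.1.trans ha.1.1, (h _ y₂).1.2.1.trans ha.1.2.1,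
    (h _ y₃).1.2.2.1.trans ha.1.2.2.1, (h _ y₄).1.2.2.2.trans ha.1.2.2.2⟩,
    ha.2.1.trans (h _ y₅).2.1, ha.2.2.1.trans (h _ y₆).2.2.1,
    ha.2.2.2.1.trans (h _ y₇).2.2.2.1, ha.2.2.2.2.trans (h _ y₈).2.2.2.2⟩

/-- The faces are minima and maxima of coordinates over `s`, attained at matches in `G`; hence boxes
with coordinates from `G` suffice. -/
theorem exists_isBoundingBox {G s : List Match} (hs : s ≠ []) (hsG : ∀ a ∈ s, a ∈ G) :
    ∃ b ∈ boxes G, IsBoundingBox s b := by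
  have hne : s.toFinset.Nonempty := by simpa using hs
  have hmin : ∀ f : Match → ℕ, ∃ a ∈ s, ∀ b ∈ s, f a ≤ f b := fun f => by
    simpa using s.toFinset.exists_min_image f hne
  have hmax : ∀ f : Match → ℕ, ∃ a ∈ s, ∀ b ∈ s, f b ≤ f a := fun f => by
    simpa using s.toFinset.exists_max_image f hne
  obtain ⟨a₁, h₁, h₁'⟩ := hmin fun a => a.1.1
  obtain ⟨a₂, h₂, h₂'⟩ := hmin fun a => a.1.2
  obtain ⟨a₃, h₃, h₃'⟩ := hmin fun a => a.2.1
  obtain ⟨a₄, h₄, h₄'⟩ := hmin fun a => a.2.2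
  obtain ⟨a₅, h₅, h₅'⟩ := hmax fun a => a.1.1
  obtain ⟨a₆, h₆, h₆'⟩ := hmax fun a => a.1.2
  obtain ⟨a₇, h₇, h₇'⟩ := hmax fun a => a.2.1
  obtain ⟨a₈, h₈, h₈'⟩ := hmax fun a => a.2.2
  refine ⟨(((a₁.1.1, a₂.1.2), (a₃.2.1, a₄.2.2)), ((a₅.1.1, a₆.1.2), (a₇.2.1, a₈.2.2))), ?_, ?_,
    ⟨⟨a₁, h₁, rfl⟩, ⟨a₂, h₂, rfl⟩, ⟨a₃, h₃, rfl⟩, ⟨a₄, h₄, rfl⟩⟩,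
    ⟨a₅, h₅, rfl⟩, ⟨a₆, h₆, rfl⟩, ⟨a₇, h₇, rfl⟩, ⟨a₈, h₈, rfl⟩⟩
  · have hc : ∀ a ∈ s, ∀ n, n = a.1.1 ∨ n = a.1.2 ∨ n = a.2.1 ∨ n = a.2.2 →
        n ∈ G.flatMap fun a => [a.1.1, a.1.2, a.2.1, a.2.2] := fun a ha n hn =>
      List.mem_flatMap.2 ⟨a, hsG a ha, by simpa using hn⟩
    exact List.pair_mem_product.2 ⟨List.pair_mem_product.2
      ⟨List.pair_mem_product.2 ⟨hc a₁ h₁ _ (by simp), hc a₂ h₂ _ (by simp)⟩,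
        List.pair_mem_product.2 ⟨hc a₃ h₃ _ (by simp), hc a₄ h₄ _ (by simp)⟩⟩,
      List.pair_mem_product.2
      ⟨List.pair_mem_product.2 ⟨hc a₅ h₅ _ (by simp), hc a₆ h₆ _ (by simp)⟩,
        List.pair_mem_product.2 ⟨hc a₇ h₇ _ (by simp), hc a₈ h₈ _ (by simp)⟩⟩⟩
  · intro a ha
    simp only [Match.inBox, Match.below, Bool.and_eq_true, decide_eq_true_eq]
    exact ⟨⟨⟨h₁' a ha, h₂' a ha⟩, ⟨h₃' a ha, h₄' a ha⟩⟩, ⟨⟨h₅' a ha, h₆' a ha⟩, ⟨h₇' a ha, h₈' a ha⟩⟩⟩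

/-- The invariant of the program. A list of at least two matches is split into two shorter ones, for
whose bounding boxes the previous table holds lists at least as long; these are compatible because
the boxes are separated like the parts. Treating all lengths up to `n` at once avoids any
monotonicity of the table in `n`. -/
theorem exists_mem_improve_iterate {G : List Match} (hG : ∀ s, Consistent G s → (firstWord s).Nodup)
    (n : ℕ) {s : List Match} (hs : Consistent G s) (hsep : SepWord (firstWord s)) (hn : s ≠ [])
    (hl : s.length ≤ n) {b : Match × Match} (hb : b ∈ boxes G) (hsb : ∀ a ∈ s, Match.inBox b a) :
    ∃ t ∈ (improve G)^[n] [], s.length ≤ t.length ∧ ∀ a ∈ t, Match.inBox b a := by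
  induction n generalizing s b with
  | zero => simp at hl; exact absurd hl hn
  | succ n ih =>
    rw [Function.iterate_succ_apply']
    set T := (improve G)^[n] [] with hT
    suffices h : ∃ t ∈ candidates G T, s.length ≤ t.length ∧ ∀ a ∈ t, Match.inBox b a by
      obtain ⟨t, ht, hst, htb⟩ := h
      have ht' : t ∈ (candidates G T).filter fun s => s.all (Match.inBox b) :=
        List.mem_filter.2 ⟨ht, by simpa using htb⟩
      refine ⟨_, List.mem_map.2 ⟨b, hb, rfl⟩, hst.trans (length_le_longest ht'), ?_⟩
      rcases longest_mem ((candidates G T).filter fun s => s.all (Match.inBox b)) with h | h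
      · simp [h]
      · simpa using (List.mem_filter.1 h).2
    by_cases h₂ : 2 ≤ s.length
    · obtain ⟨u, v, hu, hv, huv, hlt⟩ := hsep.splits (hG s hs) (by simpa [firstWord] using h₂)
      obtain ⟨s₁, s₂, rfl, rfl, rfl⟩ := List.map_eq_append_iff.1 huv
      have hc := (List.pairwise_append.1 hs.1).2.2
      have hs₁ : Consistent G s₁ := ⟨(List.pairwise_append.1 hs.1).1,
        fun a ha => hs.2 a (List.mem_append_left _ ha)⟩
      have hs₂ : Consistent G s₂ := ⟨(List.pairwise_append.1 hs.1).2.1,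
        fun a ha => hs.2 a (List.mem_append_right _ ha)⟩
      have hn₁ : s₁ ≠ [] := by simpa using hu
      have hn₂ : s₂ ≠ [] := by simpa using hv
      have hp₁ := List.length_pos_of_ne_nil hn₁
      have hp₂ := List.length_pos_of_ne_nil hn₂
      rw [List.length_append] at hl
      obtain ⟨b₁, hb₁, hbb₁⟩ := exists_isBoundingBox hn₁ hs₁.2
      obtain ⟨b₂, hb₂, hbb₂⟩ := exists_isBoundingBox hn₂ hs₂.2
      obtain ⟨t₁, ht₁, hl₁, hi₁⟩ := ih hs₁ (hsep.of_sublist ((List.sublist_append_left _ _).map _))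
        hn₁ (by omega) hb₁ hbb₁.1
      obtain ⟨t₂, ht₂, hl₂, hi₂⟩ := ih hs₂ (hsep.of_sublist ((List.sublist_append_right _ _).map _))
        hn₂ (by omega) hb₂ hbb₂.1
      obtain ⟨-, ⟨-, l₂, -, l₄⟩, l₅, l₆, l₇, l₈⟩ := id hbb₁
      obtain ⟨-, ⟨m₁, m₂, m₃, m₄⟩, -, m₆, -, m₈⟩ := id hbb₂
      -- The faces are attained in `s₁` and `s₂`, so the compatibility of these matches separates
      -- the boxes themselves.
      have hpos : b₁.2.1.1 < b₂.1.1.1 ∧ b₁.2.2.1 < b₂.1.2.1 := by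
        obtain ⟨x, hx, ex⟩ := l₅
        obtain ⟨y, hy, ey⟩ := m₁
        obtain ⟨z, hz, ez⟩ := l₇
        obtain ⟨w, hw, ew⟩ := m₃
        rw [← ex, ← ey, ← ez, ← ew]
        exact ⟨(Match.compat_iff.1 (hc x hx y hy)).1, (Match.compat_iff.1 (hc z hz w hw)).2.1⟩
      -- In the decreasing case compatibility only says that the second values do not increase; the
      -- weak inequalities are enough to make both comparisons false.
      have hval : (b₁.2.1.2 < b₂.1.1.2 ∧ b₁.2.2.2 < b₂.1.2.2) ∨
          (b₂.2.1.2 ≤ b₁.1.1.2 ∧ b₂.2.2.2 ≤ b₁.1.2.2) := by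
        have hlt' : (∀ a ∈ s₁, ∀ b ∈ s₂, a.1.2 < b.1.2) ∨ (∀ a ∈ s₁, ∀ b ∈ s₂, b.1.2 < a.1.2) :=
          hlt.imp (fun h a ha b hb => h _ (List.mem_map_of_mem ha) _ (List.mem_map_of_mem hb))
            (fun h a ha b hb => h _ (List.mem_map_of_mem ha) _ (List.mem_map_of_mem hb))
        rcases hlt' with h | h
        · left
          obtain ⟨x, hx, ex⟩ := l₆
          obtain ⟨y, hy, ey⟩ := m₂
          obtain ⟨z, hz, ez⟩ := l₈
          obtain ⟨w, hw, ew⟩ := m₄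
          rw [← ex, ← ey, ← ez, ← ew]
          exact ⟨h x hx y hy, (Match.compat_iff.1 (hc z hz w hw)).2.2.1 (h z hz w hw)⟩
        · right
          obtain ⟨x, hx, ex⟩ := l₂
          obtain ⟨y, hy, ey⟩ := m₆
          obtain ⟨z, hz, ez⟩ := l₄
          obtain ⟨w, hw, ew⟩ := m₈
          rw [← ex, ← ey, ← ez, ← ew]
          exact ⟨(h x hx y hy).le, not_lt.1 fun hzw =>
            lt_asymm ((Match.compat_iff.1 (hc z hz w hw)).2.2.2 hzw) (h z hz w hw)⟩
      refine ⟨t₁ ++ t₂, List.mem_append_right _ (List.mem_map.2 ⟨(t₁, t₂), List.mem_filter.2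
        ⟨List.pair_mem_product.2 ⟨ht₁, ht₂⟩, ?_⟩, rfl⟩), by simp; omega, fun a ha => ?_⟩
      · simp only [List.all_eq_true]
        intro a ha c hc
        have ha' := Match.inBox_iff.1 (hi₁ a ha)
        have hc' := Match.inBox_iff.1 (hi₂ c hc)
        rw [Match.compat_iff]
        omega
      · rcases List.mem_append.1 ha with ha | ha
        · exact hbb₁.inBox (fun c hc => hsb c (List.mem_append_left _ hc)) (hi₁ a ha)
        · exact hbb₂.inBox (fun c hc => hsb c (List.mem_append_right _ hc)) (hi₂ a ha)
    · obtain ⟨a, rfl⟩ : ∃ a, s = [a] := List.length_eq_one_iff.1 (by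
        have := List.length_pos_of_ne_nil hn
        omega)
      exact ⟨[a], List.mem_append_left _ (List.mem_map.2 ⟨a, hs.2 a (by simp), rfl⟩), le_rfl, hsb⟩

theorem mem_points_encodeWord (w : List ℕ) (i v : ℕ) :
    (i, v) ∈ points (Permutation.encodeWord w) ↔ w[i]? = some v := by
  have hr : ∀ (n c : ℕ) (l : List (ℕ × ℕ)), (List.replicate n true).foldl
      (fun (s : ℕ × List (ℕ × ℕ)) b =>
        bif b then (s.1 + 1, s.2) else (0, s.2 ++ [(s.2.length, s.1)])) (c, l) = (c + n, l) := by
    intro n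
    induction n with
    | zero => simp
    | succ n ih => intro c l; rw [List.replicate_succ, List.foldl_cons]; simp [ih]; omega
  suffices h : ∃ l : List (ℕ × ℕ), (Permutation.encodeWord w).foldl
      (fun (s : ℕ × List (ℕ × ℕ)) b =>
        bif b then (s.1 + 1, s.2) else (0, s.2 ++ [(s.2.length, s.1)])) (0, []) = (0, l) ∧
      l.length = w.length ∧ ∀ i v, (i, v) ∈ l ↔ w[i]? = some v by
    obtain ⟨l, hl, -, h⟩ := h
    rw [points, hl]
    exact h i v
  clear i v
  induction w using List.reverseRecOn with
  | nil => exact ⟨[], rfl, rfl, by simp⟩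
  | append_singleton w x ih =>
    obtain ⟨l, hl, hlen, h⟩ := ih
    have e : Permutation.encodeWord (w ++ [x]) =
        Permutation.encodeWord w ++ (List.replicate x true ++ [false]) := by
      simp [Permutation.encodeWord]
    refine ⟨l ++ [(l.length, x)], ?_, by simp [hlen], fun i v => ?_⟩
    · rw [e, List.foldl_append, hl, List.foldl_append, hr]
      simp
    · rw [List.mem_append, h, List.mem_singleton, Prod.mk.injEq, hlen]
      rcases lt_trichotomy i w.length with hi | rfl | hi
      · rw [List.getElem?_append_left hi]
        simp [hi.ne]
      · simp [eq_comm]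
      · rw [List.getElem?_eq_none (by omega), List.getElem?_eq_none (by simp; omega)]
        simp [hi.ne']

/-! ### Common patterns as consistent lists of matches -/

namespace Permutation

theorem mem_points_encodeWord_word (π : Permutation) (p : ℕ × ℕ) :
    p ∈ points (encodeWord π.word) ↔ ∃ i : Fin π.1, p = ((i : ℕ), (π.2 i : ℕ) + 1) := by
  obtain ⟨i, v⟩ := p
  rw [mem_points_encodeWord, word, List.getElem?_ofFn]
  by_cases h : i < π.1
  · rw [dif_pos h]
    constructor
    · exact fun e => ⟨⟨i, h⟩, by simpa [eq_comm] using e⟩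
    · rintro ⟨j, e⟩
      obtain ⟨rfl, rfl⟩ := Prod.mk.inj e
      rfl
  · rw [dif_neg h]
    simp only [reduceCtorEq, Prod.mk.injEq, false_iff, not_exists]
    rintro j ⟨rfl, -⟩
    exact h j.2

/-- The matches of the entries of two permutations. -/
def matchOf (σ τ : Permutation) (i : Fin σ.1) (j : Fin τ.1) : Match :=
  (((i : ℕ), (σ.2 i : ℕ) + 1), ((j : ℕ), (τ.2 j : ℕ) + 1))

/-- `G` consists of all matches of the entries of two permutations. -/
def IsAllMatches (G : List Match) (σ τ : Permutation) : Prop :=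
  ∀ a, a ∈ G ↔ ∃ i j, a = matchOf σ τ i j

theorem isAllMatches_allMatches (p : SeparablePair) :
    IsAllMatches (allMatches ((encodeSeparablePair p).map tagged)) p.1.1 p.1.2 := by
  rintro ⟨a, b⟩
  have e₁ : (((encodeSeparablePair p).map tagged).filter fun x => !x.1).map Prod.snd =
      encodeWord p.1.1.word := by
    simp [encodeSeparablePair, Computability.encodingProd, List.filter_map, Function.comp_def,
      tagged, encoding]
  have e₂ : (((encodeSeparablePair p).map tagged).filter fun x => x.1).map Prod.snd =
      encodeWord p.1.2.word := by
    simp [encodeSeparablePair, Computability.encodingProd, List.filter_map, Function.comp_def,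
      tagged, encoding]
  rw [allMatches, e₁, e₂]
  refine List.pair_mem_product.trans ?_
  rw [mem_points_encodeWord_word, mem_points_encodeWord_word]
  constructor
  · rintro ⟨⟨i, rfl⟩, ⟨j, rfl⟩⟩
    exact ⟨i, j, rfl⟩
  · rintro ⟨i, j, h⟩
    obtain ⟨rfl, rfl⟩ := Prod.mk.inj h
    exact ⟨⟨i, rfl⟩, ⟨j, rfl⟩⟩

variable {σ τ : Permutation} {G s : List Match}

theorem IsAllMatches.nodup_firstWord (hG : IsAllMatches G σ τ) (hs : Consistent G s) :
    (firstWord s).Nodup := by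
  refine List.pairwise_map.2 (hs.1.imp_of_mem fun {a b} ha hb hab => ?_)
  obtain ⟨i, j, rfl⟩ := (hG a).1 (hs.2 a ha)
  obtain ⟨i', j', rfl⟩ := (hG b).1 (hs.2 b hb)
  have h := (Match.compat_iff.1 hab).1
  simp only [matchOf] at h
  simp only [matchOf, ne_eq, Nat.add_right_cancel_iff, Fin.val_inj, EmbeddingLike.apply_eq_iff_eq]
  rintro rfl
  exact lt_irrefl _ h

/-- Positions in σ increase along a consistent list, so four of its entries that form a forbidden
word are an occurrence of 3142 or 2413 in σ. -/
theorem IsAllMatches.sepWord_firstWord (hG : IsAllMatches G σ τ) (hσ : σ.IsSeparable)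
    (hs : Consistent G s) : SepWord (firstWord s) := by
  intro a b c d h
  obtain ⟨s', hs', e⟩ := List.sublist_map_iff.1 h
  obtain ⟨x₁, x₂, x₃, x₄, rfl⟩ : ∃ x₁ x₂ x₃ x₄, s' = [x₁, x₂, x₃, x₄] := by
    have : s'.length = 4 := by simpa using (congrArg List.length e).symm
    match s', this with
    | [x₁, x₂, x₃, x₄], _ => exact ⟨x₁, x₂, x₃, x₄, rfl⟩
  have hm : ∀ x ∈ [x₁, x₂, x₃, x₄], ∃ i j, x = matchOf σ τ i j := fun x hx =>
    (hG x).1 (hs.2 x (hs'.subset hx))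
  obtain ⟨i₁, j₁, rfl⟩ := hm x₁ (by simp)
  obtain ⟨i₂, j₂, rfl⟩ := hm x₂ (by simp)
  obtain ⟨i₃, j₃, rfl⟩ := hm x₃ (by simp)
  obtain ⟨i₄, j₄, rfl⟩ := hm x₄ (by simp)
  have hp := hs.1.sublist hs'
  simp only [List.pairwise_cons, List.mem_cons, Match.compat_iff, matchOf, Fin.val_fin_lt,
    List.not_mem_nil, or_false, forall_eq_or_imp, forall_eq] at hp
  obtain ⟨⟨⟨h₁, -⟩, -⟩, ⟨⟨h₂, -⟩, -⟩, ⟨h₃, -⟩, -⟩ := hp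
  simp only [List.map_cons, List.map_nil, matchOf, List.cons.injEq, and_true] at e
  obtain ⟨rfl, rfl, rfl, rfl⟩ := e
  have hmono : StrictMono (![i₁, i₂, i₃, i₄] : Fin 4 → Fin σ.1) := by
    refine Fin.strictMono_iff_lt_succ.2 fun l => ?_
    fin_cases l
    · exact h₁
    · exact h₂
    · exact h₃
  constructor
  · rintro ⟨hbd, hda, hac⟩
    refine hσ.1 ⟨![i₁, i₂, i₃, i₄], hmono, ?_⟩
    have hbd : σ.2 i₂ < σ.2 i₄ := by simpa using hbd
    have hda : σ.2 i₄ < σ.2 i₁ := by simpa using hda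
    have hac : σ.2 i₁ < σ.2 i₃ := by simpa using hac
    intro l m hlm
    change (![2, 0, 3, 1] : Fin 4 → Fin 4) l < (![2, 0, 3, 1] : Fin 4 → Fin 4) m at hlm
    change Fin 4 at l m
    fin_cases l <;> fin_cases m <;> first | (exact absurd hlm (by decide)) | skip
    all_goals
      simp only [Fin.lt_def] at *
      simp
      omega
  · rintro ⟨hca, had, hdb⟩
    refine hσ.2 ⟨![i₁, i₂, i₃, i₄], hmono, ?_⟩
    have hca : σ.2 i₃ < σ.2 i₁ := by simpa using hca
    have had : σ.2 i₁ < σ.2 i₄ := by simpa using had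
    have hdb : σ.2 i₄ < σ.2 i₂ := by simpa using hdb
    intro l m hlm
    change (![1, 3, 0, 2] : Fin 4 → Fin 4) l < (![1, 3, 0, 2] : Fin 4 → Fin 4) m at hlm
    change Fin 4 at l m
    fin_cases l <;> fin_cases m <;> first | (exact absurd hlm (by decide)) | skip
    all_goals
      simp only [Fin.lt_def] at *
      simp
      omega

/-- The l-th entries of the two occurrences are matched; values compare alike since both follow π,
whose values at distinct places differ. -/
theorem IsCommonPattern.exists_consistent {π : Permutation} (hG : IsAllMatches G σ τ)
    (h : IsCommonPattern π σ τ) : ∃ s, Consistent G s ∧ s.length = π.size := by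
  obtain ⟨⟨i, hi, hi'⟩, ⟨j, hj, hj'⟩⟩ := h
  refine ⟨List.ofFn fun l => matchOf σ τ (i l) (j l), ⟨?_, ?_⟩, by simp⟩
  · rw [List.pairwise_ofFn]
    intro l m hlm
    rw [Match.compat_iff]
    refine ⟨hi hlm, hj hlm, ?_⟩
    simp only [matchOf, Nat.add_lt_add_iff_right, Fin.val_fin_lt]
    rcases lt_trichotomy (π.2 l) (π.2 m) with h | h | h
    · exact iff_of_true (hi' l m h) (hj' l m h)
    · exact absurd (π.2.injective h) hlm.ne
    · exact iff_of_false (hi' m l h).not_gt (hj' m l h).not_gt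
  · intro a ha
    obtain ⟨l, rfl⟩ := (List.mem_ofFn' _ _).1 ha
    exact (hG _).2 ⟨_, _, rfl⟩

/-- The pattern is the standardization of the first word: each value is replaced by its rank among
the values that occur. -/
theorem Consistent.exists_pattern (hG : IsAllMatches G σ τ) (hs : Consistent G s) :
    ∃ π : Permutation, π.word = ranks s ∧ π.size = s.length ∧ IsCommonPattern π σ τ := by
  have hm : ∀ l : Fin s.length, ∃ i j, s[l] = matchOf σ τ i j := fun l =>
    (hG _).1 (hs.2 _ (List.getElem_mem _))
  choose i j hij using hm
  have hc : ∀ l m : Fin s.length, l < m → (i l < i m ∧ j l < j m ∧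
      (σ.2 (i l) < σ.2 (i m) ↔ τ.2 (j l) < τ.2 (j m))) := by
    intro l m hlm
    have h := List.pairwise_iff_getElem.1 hs.1 l m l.2 m.2 hlm
    have h₁ := hij l
    have h₂ := hij m
    simp only [Fin.getElem_fin] at h₁ h₂
    rw [h₁, h₂, Match.compat_iff] at h
    simpa [matchOf] using h
  have hi : StrictMono i := fun l m h => (hc l m h).1
  have hj : StrictMono j := fun l m h => (hc l m h).2.1
  -- Compatibility concerns only pairs in the order of the list; for the reverse order it excludes
  -- the opposite strict inequality, and injectivity excludes equality.
  have hστ : ∀ l m, σ.2 (i l) < σ.2 (i m) → τ.2 (j l) < τ.2 (j m) := by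
    intro l m h
    rcases lt_trichotomy l m with hlm | rfl | hlm
    · exact (hc l m hlm).2.2.1 h
    · exact absurd h (lt_irrefl _)
    · refine lt_of_le_of_ne (not_lt.1 fun h' => lt_asymm h ((hc m l hlm).2.2.2 h')) ?_
      exact fun e => hlm.ne' (hj.injective (τ.2.injective e))
  have hy : ∀ l, (s[l]).1.2 = (σ.2 (i l) : ℕ) + 1 := fun l => by rw [hij l]; rfl
  let r : Fin s.length → ℕ := fun l => (s.filter fun b => decide (b.1.2 ≤ (s[l]).1.2)).length
  have hr : ∀ l m, σ.2 (i l) < σ.2 (i m) → r l < r m := by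
    intro l m h
    -- The entries counted for `l` are among those counted for `m`, and `s[m]` itself is counted
    -- only for `m`.
    have e : (s.filter fun b => decide (b.1.2 ≤ (s[l]).1.2)) =
        (s.filter fun b => decide (b.1.2 ≤ (s[m]).1.2)).filter
          fun b => decide (b.1.2 ≤ (s[l]).1.2) := by
      rw [List.filter_filter]
      refine List.filter_congr fun b _ => ?_
      rw [hy, hy]
      have : (σ.2 (i l) : ℕ) < σ.2 (i m) := h
      simp; omega
    simp only [r]
    rw [e, List.length_filter_lt_length_iff_exists]
    refine ⟨s[m], List.mem_filter.2 ⟨List.getElem_mem _, by simp⟩, ?_⟩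
    have : (σ.2 (i l) : ℕ) < σ.2 (i m) := h
    rw [hy, hy]
    simpa using this
  have hr_pos : ∀ l, 1 ≤ r l := fun l =>
    List.length_pos_of_mem (a := s[l]) (List.mem_filter.2 ⟨List.getElem_mem _, by simp⟩)
  have hr_le : ∀ l, r l ≤ s.length := fun l => List.length_filter_le _ _
  have hr_inj : Function.Injective r := by
    intro l m h
    rcases lt_trichotomy (σ.2 (i l)) (σ.2 (i m)) with h' | h' | h'
    · exact absurd h (hr l m h').ne
    · exact hi.injective (σ.2.injective h')
    · exact absurd h (hr m l h').ne'
  -- Ranks start at 1, elements of `Fin` at 0.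
  let g : Fin s.length → Fin s.length := fun l => ⟨r l - 1, by
    have := hr_pos l
    have := hr_le l
    omega⟩
  have hg : Function.Injective g := fun l m h => hr_inj (by
    have h₁ := hr_pos l
    have h₂ := hr_pos m
    have h₃ : r l - 1 = r m - 1 := congrArg Fin.val h
    omega)
  have hgr : ∀ l, (g l : ℕ) + 1 = r l := fun l => Nat.sub_add_cancel (hr_pos l)
  have hgσ : ∀ l m, g l < g m → σ.2 (i l) < σ.2 (i m) := by
    intro l m h
    rw [Fin.lt_def] at h
    have h₁ := hgr l
    have h₂ := hgr m
    by_contra h'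
    rcases lt_or_eq_of_le (not_lt.1 h') with h' | h'
    · have := hr m l h'
      omega
    · rw [hi.injective (σ.2.injective h')] at h
      exact lt_irrefl _ h
  refine ⟨⟨s.length, Equiv.ofBijective g (Finite.injective_iff_bijective.1 hg)⟩, ?_, rfl,
    ⟨i, hi, hgσ⟩, ⟨j, hj, fun l m h => hστ l m (hgσ l m h)⟩⟩
  simp only [word, Equiv.ofBijective_apply, hgr]
  refine List.ext_getElem (by simp [ranks]) fun n h₁ h₂ => ?_
  simp [ranks, r]

theorem iterate_improve_eq_table (G : List Match) : table G = (improve G)^[G.length] [] := by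
  have : ∀ (l : List Match) T, l.foldl (fun T _ => improve G T) T = (improve G)^[l.length] T := by
    intro l
    induction l with
    | nil => intro T; rfl
    | cons a l ih => intro T; simp [ih]
  exact this G []

theorem exists_solution (p : SeparablePair) :
    ∃ π : Permutation, IsLongestCommonPattern π p.1.1 p.1.2 ∧
      encoding.encode π = solution ((encodeSeparablePair p).map tagged) := by
  have hG := isAllMatches_allMatches p
  set G := allMatches ((encodeSeparablePair p).map tagged)
  have hs : Consistent G (longest (table G)) := by
    rcases longest_mem (table G) with h | h
    · rw [h]; exact .nil G
    · exact .of_mem_foldl h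
  obtain ⟨π, hw, hl, hπ⟩ := Consistent.exists_pattern hG hs
  refine ⟨π, ⟨hπ, fun ρ hρ => ?_⟩, congrArg encodeWord hw⟩
  obtain ⟨s, hs, e⟩ := hρ.exists_consistent hG
  rw [hl, ← e]
  -- The empty list has no bounding box and is treated separately.
  by_cases hn : s = []
  · simp [hn]
  obtain ⟨b, hb, hsb⟩ := exists_isBoundingBox hn hs.2
  -- |G| rounds suffice, since a consistent list has no repeated match.
  obtain ⟨t, ht, hst, -⟩ := exists_mem_improve_iterate (fun s hs => hG.nodup_firstWord hs) G.length hs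
    (hG.sepWord_firstWord p.2 hs) hn hs.length_le hb hsb.1
  rw [← iterate_improve_eq_table] at ht
  exact hst.trans (length_le_longest ht)

end Permutation

/-- The problem of finding a longest common pattern between two permutations, the first one being
separable, is solvable in polynomial time. -/
theorem theorem1 :
    SolvableInPolyTime encodeSeparablePair Permutation.encoding.encode
      (fun (p : SeparablePair) (π : Permutation) =>
        Permutation.IsLongestCommonPattern π p.1.1 p.1.2) := by
  choose f hf hf' using Permutation.exists_solution
  exact ⟨f, hf, PolyTime.solution.computable hf'⟩
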